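/- Let $G$ be an $N$-dimensional connected Lie group with Lie algebra $\mathfrak g$, let $X_1,\dots,X_N$ be a basis of $\mathfrak g$, and suppose that $\exp:\mathfrak g\to G$ is surjective. For $\tau\in\mathbb R^N$ let $M(\tau)$ be the $N\times N$ matrix whose $j$-th column is the $j$-th column of the matrix, in the basis $X_1,\dots,X_N$, of $e^{\tau_1\operatorname{ad}X_1}e^{\tau_2\operatorname{ad}X_2}\cdots e^{\tau_{j-1}\operatorname{ad}X_{j-1}}$ (so $M(0)=I$). For $Y=\sum_j y_jX_j\in\mathfrak g$, a solution of the Wei–Norman equations for $Y$ on $[0,s]$ is a curve $\tau:[0,s]\to\mathbb R^N$ with $\tau(0)=0$, with $M(\tau(t))$ invertible, and with $\dot\tau(t)=M(\tau(t))^{-1}(y_1,\dots,y_N)^{T}$ for all $t\in[0,s]$. Fix a threshold $0<\varepsilon<1$, and let $\gamma=e^X$ with $X\in\mathfrak g$ be an arbitrary element of $G$. Consider the following algorithm. 1. Let $t$ run through $[0,1]$, solving the Wei–Norman equations for $X$. Break at the first time $t$ (as an infimum) at which $\det M(\tau(t))$ falls below $\varepsilon$; break also at time $t$ if $\det M(\tau)\ge\varepsilon$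 before time $t$ but the equations have no solution on $[0,t]$. If there is no break, that is, if the solution exists on $[0,1]$ with $\det M(\tau(t))\ge\varepsilon$ throughout, return $\tau(1)$ and $n=1$. 2. If the first loop breaks at time $t$, put $n=\lfloor 1/t\rfloor+1$, solve the Wei–Norman equations for $X/n$ on $[0,1]$, and return $\tau(1)$ and $n$. This algorithm terminates with a well-defined (unique) output $(\tau,n)$, where $n\ge 1$; in particular, in step 2 the Wei–Norman equations for $X/n$ do have a solution on all of $[0,1]$. The output $\tau$ gives canonical coordinates of the second kind for $\gamma_n=\exp(X/n)$, and $\gamma$ is the $n$-th power of $\gamma_n$: $$e^{\tau_1X_1}e^{\tau_2X_2}\cdots e^{\tau_NX_N}=\exp\!\left(\frac Xn\right),\qquad \gamma=\left(e^{\tau_1X_1}e^{\tau_2X_2}\cdots e^{\tau_NX_N}\right)^{n}.$$ -/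

import Mathlib

open Set Matrix
open scoped Manifold ContDiff

noncomputable section

/-! ### The exponential map of a Lie group -/

/-- Over `ℝ`, smooth implies `C^3`; this lets the Lie algebra structure on the tangent space at the
identity be found for smooth real Lie groups. -/
instance leInfty_minSmoothness_three : ENat.LEInfty (minSmoothness ℝ 3) :=
  ⟨by rw [minSmoothness_of_isRCLikeNormedField]; exact ENat.LEInfty.out⟩

section LieExp

variable {E : Type*} [NormedAddCommGroup E] [NormedSpace ℝ E]
  {H : Type*} [TopologicalSpace H] {I : ModelWithCorners ℝ E H}
  {G : Type*} [TopologicalSpace G] [ChartedSpace H G] [Group G] [LieGroup I ∞ G]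

/-- Left-invariance of the vector field generated by a vector at the identity. -/
theorem mfderiv_mulInvariantVectorField (v : GroupLieAlgebra I G) (g h : G) :
    mfderiv I I (fun x : G => g * x) h (mulInvariantVectorField v h) =
      mulInvariantVectorField v (g * h) := by
  have hd : ∀ a b : G, MDifferentiableAt I I (fun x : G => a * x) b := fun a b =>
    (contMDiff_mul_left (I := I) (n := ∞) (a := a)).contMDiffAt.mdifferentiableAt (by simp)
  have hc : (fun x : G => g * h * x) = (fun x => g * x) ∘ (fun x => h * x) := by
    ext x; simp [mul_assoc]
  have hk : ∀ (k : G) (w : E), k = h →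
      (mfderiv I I (fun x : G => g * x) k : E →L[ℝ] E) w =
        (mfderiv I I (fun x : G => g * x) h : E →L[ℝ] E) w := by
    rintro _ w rfl; rfl
  have hcomp := mfderiv_comp (I := I) (I' := I) (I'' := I) (1 : G)
    (hd g (h * 1)) (hd h 1)
  rw [← hc] at hcomp
  exact ((DFunLike.congr_fun hcomp v).trans (hk (h * 1) _ (mul_one h))).symm

/-- Left-invariant vector fields are complete: there is a global integral curve through `1`. -/
theorem exists_isMIntegralCurve_mulInvariantVectorField [CompleteSpace E]
    [BoundarylessManifold I G] [T2Space G] (X : GroupLieAlgebra I G) :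
    ∃ γ : ℝ → G, γ 0 = 1 ∧ IsMIntegralCurve γ (mulInvariantVectorField X) := by
  have hv : ContMDiff I I.tangent 1
      (fun g : G => (⟨g, mulInvariantVectorField X g⟩ : TangentBundle I G)) :=
    (contMDiff_mulInvariantVectorField X).of_le (by
      rw [minSmoothness_of_isRCLikeNormedField]; exact one_le_two)
  have : IsManifold I 1 G := IsManifold.of_le (n := ∞) (by simp)
  obtain ⟨γ, h0, hγ⟩ := exists_isMIntegralCurveAt_of_contMDiffAt_boundaryless (t₀ := 0)
    (hv.contMDiffAt (x := (1 : G)))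
  rw [isMIntegralCurveAt_iff'] at hγ
  obtain ⟨ε, hε, hγ⟩ := hγ
  rw [Real.ball_eq_Ioo, zero_sub, zero_add] at hγ
  refine exists_isMIntegralCurve_of_isMIntegralCurveOn hv hε (fun g => ?_) 1
  refine ⟨fun t => g * γ t, by simp [h0], fun t ht => ?_⟩
  have hd : MDifferentiableAt I I (fun x : G => g * x) (γ t) :=
    (contMDiff_mul_left (I := I) (n := ∞) (a := g)).contMDiffAt.mdifferentiableAt (by simp)
  have := hd.hasMFDerivAt.comp_hasMFDerivWithinAt t (hγ t ht)
  have heq : (mfderiv I I (fun x : G => g * x) (γ t)).comp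
      (ContinuousLinearMap.smulRight (1 : ℝ →L[ℝ] ℝ) (mulInvariantVectorField X (γ t))) =
      ContinuousLinearMap.smulRight (1 : ℝ →L[ℝ] ℝ) (mulInvariantVectorField X (g * γ t)) := by
    refine ContinuousLinearMap.ext_ring ?_
    rw [← mfderiv_mulInvariantVectorField]
    change (mfderiv I I (fun x : G => g * x) (γ t)) ((1 : ℝ) • mulInvariantVectorField X (γ t)) =
      (1 : ℝ) • (mfderiv I I (fun x : G => g * x) (γ t)) (mulInvariantVectorField X (γ t))
    exact map_smul _ _ _
  exact heq ▸ this

/-- The exponential map of a Lie group: `lieExp X` is the value at time `1` of the integral curve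
through `1` of the left-invariant vector field with value `X` at `1`, that is, of the one-parameter
subgroup with velocity `X`. -/
def lieExp [CompleteSpace E] [BoundarylessManifold I G] [T2Space G]
    (X : GroupLieAlgebra I G) : G :=
  (exists_isMIntegralCurve_mulInvariantVectorField X).choose 1

/-- The product `exp (τ₁ X₁) * exp (τ₂ X₂) * ⋯ * exp (τ_N X_N)`, in this order: the group element
with canonical coordinates of the second kind `τ` relative to `X₁, …, X_N`. -/
def secondKindProduct [CompleteSpace E] [BoundarylessManifold I G] [T2Space G] {N : ℕ}
    (X : Fin N → GroupLieAlgebra I G) (τ : Fin N → ℝ) : G :=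
  (List.ofFn fun j => lieExp (τ j • X j)).prod

end LieExp

/-! ### The Wei–Norman equations -/

section WeiNorman

variable {N : ℕ} {L : Type*} [LieRing L] [LieAlgebra ℝ L]

/-- The matrix of `e^{s ad(X_k)}` in the basis `X₁, …, X_N`. -/
def expAdMatrix (b : Module.Basis (Fin N) ℝ L) (k : Fin N) (s : ℝ) : Matrix (Fin N) (Fin N) ℝ :=
  NormedSpace.exp (s • LinearMap.toMatrix b b (LieAlgebra.ad ℝ L (b k) : L →ₗ[ℝ] L))

/-- The Wei–Norman matrix `M(τ)`: its `j`-th column is the `j`-th column of the matrix of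
`e^{τ₁ ad(X₁)} e^{τ₂ ad(X₂)} ⋯ e^{τ_{j-1} ad(X_{j-1})}`. -/
def weiNormanMatrix (b : Module.Basis (Fin N) ℝ L) (τ : Fin N → ℝ) : Matrix (Fin N) (Fin N) ℝ :=
  Matrix.of fun i j =>
    ((((List.finRange N).take j).map fun k => expAdMatrix b k (τ k)).prod) i j

/-- `τ` solves the Wei–Norman equations for `Y` on the time interval `[0, s]`:
`τ(0) = 0`, the matrix `M(τ(t))` is invertible, and `dτ/dt = M(τ)⁻¹ y`, where `y` is the coordinate
vector of `Y`. -/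
structure IsWeiNormanSolution (b : Module.Basis (Fin N) ℝ L) (Y : L) (s : ℝ)
    (τ : ℝ → Fin N → ℝ) : Prop where
  initial : τ 0 = 0
  det_ne_zero : ∀ t ∈ Icc 0 s, (weiNormanMatrix b (τ t)).det ≠ 0
  hasDeriv : ∀ t ∈ Icc 0 s,
    HasDerivWithinAt τ ((weiNormanMatrix b (τ t))⁻¹ *ᵥ (b.repr Y : Fin N → ℝ)) (Icc 0 s) t

/-! ### The algorithm -/

/-- The first loop runs on `[0, s]` without breaking along the curve `τ`: the Wei–Norman equations
are solved there and the determinant stays at or above the threshold. -/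
def LoopRuns (b : Module.Basis (Fin N) ℝ L) (ε : ℝ) (Y : L) (s : ℝ) (τ : ℝ → Fin N → ℝ) : Prop :=
  IsWeiNormanSolution b Y s τ ∧ ∀ t ∈ Icc 0 s, ε ≤ (weiNormanMatrix b (τ t)).det

/-- The first loop breaks because the determinant falls below `ε`, and `t` is the first such time
(the infimum of the times at which the determinant is below `ε`). -/
def DetBreak (b : Module.Basis (Fin N) ℝ L) (ε : ℝ) (X : L) (t : ℝ) : Prop :=
  ∃ (s : ℝ) (τ : ℝ → Fin N → ℝ), s ≤ 1 ∧ IsWeiNormanSolution b X s τ ∧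
    IsGLB {u | u ∈ Icc 0 s ∧ (weiNormanMatrix b (τ u)).det < ε} t

/-- The first loop breaks at time `t` because, although the determinant is at least `ε` before
time `t`, the Wei–Norman equations have no solution on `[0, t]` (the solution escapes to
infinity as time `t` is approached). -/
def BlowUpBreak (b : Module.Basis (Fin N) ℝ L) (ε : ℝ) (X : L) (t : ℝ) : Prop :=
  t ∈ Icc (0 : ℝ) 1 ∧ (∀ s ∈ Ico 0 t, ∃ τ, LoopRuns b ε X s τ) ∧
    ¬ ∃ τ, IsWeiNormanSolution b X t τ

/-- The algorithm, run on `X` with threshold `ε`, terminates and returns the pair `(τ, n)`.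
Either the first loop reaches `t = 1` without a break, and `τ(1)` and `1` are returned; or it breaks
at some time `t`, one sets `n = ⌊1/t⌋ + 1`, the second loop solves the Wei–Norman equations for
`X/n` on all of `[0, 1]`, and `τ(1)` and `n` are returned. -/
inductive AlgorithmReturns (b : Module.Basis (Fin N) ℝ L) (ε : ℝ) (X : L) :
    (Fin N → ℝ) → ℕ → Prop
  | direct (τ : ℝ → Fin N → ℝ) (h : LoopRuns b ε X 1 τ) :
      AlgorithmReturns b ε X (τ 1) 1
  | rescaled (t : ℝ) (ht : DetBreak b ε X t ∨ BlowUpBreak b ε X t) (n : ℕ)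
      (hn : n = ⌊1 / t⌋₊ + 1) (τ : ℝ → Fin N → ℝ)
      (h : IsWeiNormanSolution b ((n : ℝ)⁻¹ • X) 1 τ) :
      AlgorithmReturns b ε X (τ 1) n

end WeiNorman

end

/-! Geometry. Write velocities in `G` as right translates of vectors at the identity. The right
velocity of $e^{\tau_1X_1}\cdots e^{\tau_NX_N}$ is
$\sum_j\dot\tau_j\,\mathrm{Ad}(e^{\tau_1X_1}\cdots e^{\tau_{j-1}X_{j-1}})X_j$
(`hasRightVelocityWithinAt_list_prod`). Since $\mathrm{Ad}(e^{sX_k})=e^{s\,\mathrm{ad}X_k}$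
(`groupAdMatrix_lieExp_smul`), its coordinate vector is $M(\tau)\dot\tau$. The Wei–Norman equations
for $Y$ thus say that the product has constant right velocity $Y$. Such a curve through the identity
is $e^{tY}$ (`eq_lieExp_of_hasRightVelocityWithinAt`), so at time 1 the product is $\exp Y$. Taking
$Y=X/n$ and the $n$-th power gives $\gamma$.

Termination. The field $M(\tau)^{-1}y$ is $C^1$ where $\det M\ne0$, so solutions are unique and
extend beyond any closed interval on which they exist. If the determinant never drops below
$\varepsilon$, the loop therefore reaches 1 or breaks at the supremum of the solvable times. A break
of either kind occurs at some $t>0$, because $\det M(0)=1>\varepsilon$; the loop runs on $[0,r]$ for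
$0\le r<t$ and not for $r>t$, so the break time is unique. The field is linear in $Y$, hence
$u\mapsto\tau(u/n)$ solves the equations for $X/n$ on $[0,1]$ as soon as $1/n<t$. -/

noncomputable section

set_option linter.unusedSectionVars false

/-! ### Translations, the adjoint representation and velocities of curves -/

section Translations

variable {E : Type*} [NormedAddCommGroup E] [NormedSpace ℝ E]
  {H : Type*} [TopologicalSpace H] (I : ModelWithCorners ℝ E H)
  {G : Type*} [TopologicalSpace G] [ChartedSpace H G] [Group G]

/-- The differential at `h` of left multiplication by `g`, as an endomorphism of the model space. -/
def leftDeriv (g h : G) : E →L[ℝ] E := mfderiv I I (fun x : G => g * x) h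

/-- The differential at `h` of right multiplication by `g`, as an endomorphism of the model
space. -/
def rightDeriv (g h : G) : E →L[ℝ] E := mfderiv I I (fun x : G => x * g) h

/-- The adjoint representation of a Lie group on its tangent space at the identity. -/
def groupAd (g : G) : E →L[ℝ] E := (rightDeriv I g⁻¹ g).comp (leftDeriv I g 1)

/-- The curve `c` has velocity `v` at `t`, within `s`. -/
def HasVelocityWithinAt (c : ℝ → G) (v : E) (s : Set ℝ) (t : ℝ) : Prop :=
  HasMFDerivWithinAt 𝓘(ℝ, ℝ) I c s t
    ((ContinuousLinearMap.smulRight (1 : ℝ →L[ℝ] ℝ) v : ℝ →L[ℝ] E))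

/-- The velocity of `c` at `t`, within `s`, is the right translate of `ξ`. -/
def HasRightVelocityWithinAt (c : ℝ → G) (ξ : E) (s : Set ℝ) (t : ℝ) : Prop :=
  HasVelocityWithinAt I c (rightDeriv I (c t) 1 ξ) s t

variable {I} [LieGroup I ∞ G]

theorem mdifferentiable_mul_left' (a : G) : MDifferentiable I I (fun x : G => a * x) := fun b =>
  (contMDiff_mul_left (I := I) (n := ∞) (a := a)).contMDiffAt.mdifferentiableAt (by simp)

theorem mdifferentiable_mul_right' (a : G) : MDifferentiable I I (fun x : G => x * a) := fun b =>
  (contMDiff_mul_right (I := I) (n := ∞) (a := a)).contMDiffAt.mdifferentiableAt (by simp)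

theorem leftDeriv_mul (g h k : G) :
    leftDeriv I (g * h) k = (leftDeriv I g (h * k)).comp (leftDeriv I h k) := by
  have hc : (fun x : G => g * h * x) = (fun x => g * x) ∘ (fun x => h * x) := by
    ext x; simp [mul_assoc]
  unfold leftDeriv
  rw [hc]
  exact mfderiv_comp (I := I) (I' := I) (I'' := I) k (mdifferentiable_mul_left' g (h * k))
    (mdifferentiable_mul_left' h k)

theorem rightDeriv_mul (g h k : G) :
    rightDeriv I (g * h) k = (rightDeriv I h (k * g)).comp (rightDeriv I g k) := by
  have hc : (fun x : G => x * (g * h)) = (fun x => x * h) ∘ (fun x => x * g) := by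
    ext x; simp [mul_assoc]
  unfold rightDeriv
  rw [hc]
  exact mfderiv_comp (I := I) (I' := I) (I'' := I) k (mdifferentiable_mul_right' h (k * g))
    (mdifferentiable_mul_right' g k)

theorem leftDeriv_comp_rightDeriv (g h k : G) :
    (leftDeriv I g (k * h)).comp (rightDeriv I h k) =
      (rightDeriv I h (g * k)).comp (leftDeriv I g k) := by
  have hc : (fun x : G => g * x) ∘ (fun x => x * h) = (fun x => x * h) ∘ (fun x => g * x) := by
    ext x; simp [mul_assoc]
  have h1 := mfderiv_comp (I := I) (I' := I) (I'' := I) k (mdifferentiable_mul_left' g (k * h))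
    (mdifferentiable_mul_right' h k)
  have h2 := mfderiv_comp (I := I) (I' := I) (I'' := I) k (mdifferentiable_mul_right' h (g * k))
    (mdifferentiable_mul_left' g k)
  rw [hc] at h1
  exact h1.symm.trans h2

variable (I) in
theorem leftDeriv_one (h : G) : leftDeriv I 1 h = ContinuousLinearMap.id ℝ E := by
  have hc : (fun x : G => 1 * x) = id := by ext x; simp
  unfold leftDeriv
  rw [hc]
  exact mfderiv_id

variable (I) in
theorem rightDeriv_one (h : G) : rightDeriv I 1 h = ContinuousLinearMap.id ℝ E := by
  have hc : (fun x : G => x * 1) = id := by ext x; simp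
  unfold rightDeriv
  rw [hc]
  exact mfderiv_id

/-- Right translation by $g$ undoes the right translation by $g^{-1}$ in the definition of
`groupAd`. This is how left translates become right translates below. -/
theorem rightDeriv_groupAd (g : G) (η : E) :
    rightDeriv I g 1 (groupAd I g η) = leftDeriv I g 1 η := by
  have h := rightDeriv_mul (I := I) g⁻¹ g g
  rw [inv_mul_cancel, mul_inv_cancel, rightDeriv_one] at h
  exact (DFunLike.congr_fun h (leftDeriv I g 1 η)).symm

variable (I) in
theorem groupAd_one : groupAd I (1 : G) = ContinuousLinearMap.id ℝ E := by
  simp [groupAd, leftDeriv_one, rightDeriv_one]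

/-- Left and right translations commute, so the two conjugations can be regrouped. -/
theorem groupAd_mul (g h : G) : groupAd I (g * h) = (groupAd I g).comp (groupAd I h) := by
  have h1 := rightDeriv_mul (I := I) h⁻¹ g⁻¹ (g * h)
  have h2 := leftDeriv_mul (I := I) g h 1
  have h3 := leftDeriv_comp_rightDeriv (I := I) g h⁻¹ h
  rw [mul_inv_cancel_right] at h1
  rw [mul_one] at h2
  rw [mul_inv_cancel] at h3
  unfold groupAd
  rw [_root_.mul_inv_rev, h1, h2]
  ext η
  have := DFunLike.congr_fun h3 (leftDeriv I h 1 η)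
  simp only [ContinuousLinearMap.comp_apply] at this ⊢
  rw [this]

theorem HasMFDerivWithinAt.hasVelocityWithinAt {c : ℝ → G} {s : Set ℝ} {t : ℝ} {f' : ℝ →L[ℝ] E}
    {v : E} (h : HasMFDerivWithinAt 𝓘(ℝ, ℝ) I c s t f') (hv : f' 1 = v) :
    HasVelocityWithinAt I c v s t := by
  have : f' = ContinuousLinearMap.smulRight (1 : ℝ →L[ℝ] ℝ) v :=
    ContinuousLinearMap.ext_ring (by simp [hv])
  rw [this] at h
  exact h

/-- Product rule for curves in a Lie group. -/
theorem HasVelocityWithinAt.mul {a b : ℝ → G} {v w : E} {s : Set ℝ} {t : ℝ}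
    (ha : HasVelocityWithinAt I a v s t) (hb : HasVelocityWithinAt I b w s t) :
    HasVelocityWithinAt I (fun u => a u * b u)
      (rightDeriv I (b t) (a t) v + leftDeriv I (a t) (b t) w) s t := by
  have hm : MDifferentiableAt (I.prod I) I (fun p : G × G => p.1 * p.2) (a t, b t) :=
    (contMDiff_mul I ∞).mdifferentiable (by simp) _
  have h := hm.hasMFDerivAt.comp_hasMFDerivWithinAt t (HasMFDerivWithinAt.prodMk ha hb)
  refine HasMFDerivWithinAt.hasVelocityWithinAt h ?_
  refine (mfderiv_prod_eq_add_apply (v := ((1 : ℝ) • v, (1 : ℝ) • w)) hm).trans ?_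
  change rightDeriv I (b t) (a t) ((1 : ℝ) • v) + leftDeriv I (a t) (b t) ((1 : ℝ) • w) = _
  rw [one_smul, one_smul]

/-- The product rule leaves a left translate by $a(t)$ of the second velocity; rewriting it as a
right translate produces the factor $\mathrm{Ad}(a(t))$. -/
theorem HasRightVelocityWithinAt.mul {a b : ℝ → G} {ξ η : E} {s : Set ℝ} {t : ℝ}
    (ha : HasRightVelocityWithinAt I a ξ s t) (hb : HasRightVelocityWithinAt I b η s t) :
    HasRightVelocityWithinAt I (fun u => a u * b u) (ξ + groupAd I (a t) η) s t := by
  have h := HasVelocityWithinAt.mul ha hb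
  unfold HasRightVelocityWithinAt
  convert! h using 1
  have h1 := leftDeriv_comp_rightDeriv (I := I) (a t) (b t) 1
  have h2 := rightDeriv_mul (I := I) (a t) (b t) 1
  rw [one_mul, mul_one] at h1
  rw [one_mul] at h2
  have h3 := DFunLike.congr_fun h1 η
  simp only [ContinuousLinearMap.comp_apply] at h3
  rw [h3, ← rightDeriv_groupAd, h2, map_add]
  rfl

theorem HasVelocityWithinAt.comp {a : ℝ → G} {f : ℝ → ℝ} {v : E} {f' : ℝ} {s : Set ℝ} {t : ℝ}
    (ha : HasVelocityWithinAt I a v univ (f t)) (hf : HasDerivWithinAt f f' s t) :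
    HasVelocityWithinAt I (fun u => a (f u)) (f' • v) s t := by
  have h1 : HasMFDerivAt 𝓘(ℝ, ℝ) I a (f t)
    ((ContinuousLinearMap.smulRight (1 : ℝ →L[ℝ] ℝ) v : ℝ →L[ℝ] E)) :=
    HasMFDerivWithinAt.hasMFDerivAt ha Filter.univ_mem
  have h := h1.comp_hasMFDerivWithinAt t hf.hasFDerivWithinAt.hasMFDerivWithinAt
  refine HasMFDerivWithinAt.hasVelocityWithinAt h ?_
  change ((1 : ℝ) • f') • v = f' • v
  simp

theorem HasRightVelocityWithinAt.comp {a : ℝ → G} {f : ℝ → ℝ} {ξ : E} {f' : ℝ} {s : Set ℝ} {t : ℝ}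
    (ha : HasRightVelocityWithinAt I a ξ univ (f t)) (hf : HasDerivWithinAt f f' s t) :
    HasRightVelocityWithinAt I (fun u => a (f u)) (f' • ξ) s t := by
  have h := HasVelocityWithinAt.comp ha hf
  unfold HasRightVelocityWithinAt
  rwa [map_smul]

theorem hasRightVelocityWithinAt_one (s : Set ℝ) (t : ℝ) :
    HasRightVelocityWithinAt I (fun _ => (1 : G)) 0 s t := by
  unfold HasRightVelocityWithinAt
  rw [map_zero]
  exact HasMFDerivWithinAt.hasVelocityWithinAt
    (hasMFDerivWithinAt_const (I := 𝓘(ℝ, ℝ)) (I' := I) (1 : G) s t) rfl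

theorem HasVelocityWithinAt.continuousWithinAt {c : ℝ → G} {v : E} {s : Set ℝ} {t : ℝ}
    (h : HasVelocityWithinAt I c v s t) : ContinuousWithinAt c s t :=
  HasMFDerivWithinAt.continuousWithinAt h

/-- A curve with vanishing velocity on `[a, b]` has equal end points. -/
theorem eq_of_hasVelocityWithinAt_zero [CompleteSpace E] [BoundarylessManifold I G] [T2Space G]
    {c : ℝ → G} {a b : ℝ} (hab : a < b)
    (h : ∀ t ∈ Icc a b, HasVelocityWithinAt I c 0 (Icc a b) t) : c a = c b := by
  have hI : IsManifold I 1 G := IsManifold.of_le (n := ∞) (by simp)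
  have hmid : (a + b) / 2 ∈ Ioo a b := ⟨by linarith, by linarith⟩
  -- Uniqueness of integral curves, here of the zero field, applies on the open interval; continuity
  -- then reaches the end points.
  have hconst : EqOn c (fun _ => c ((a + b) / 2)) (Ioo a b) := by
    refine isMIntegralCurveOn_Ioo_eqOn_of_contMDiff_boundaryless (I := I)
      (v := fun x => (0 : TangentSpace I x)) hmid
      (Bundle.contMDiff_zeroSection ℝ (TangentSpace I : G → Type _)) ?_ ?_ rfl
    · intro t ht
      exact HasMFDerivWithinAt.mono (h t (Ioo_subset_Icc_self ht)) Ioo_subset_Icc_self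
    · exact (isMIntegralCurve_const rfl).isMIntegralCurveOn _
  have hcont : ContinuousOn c (Icc a b) := fun t ht => (h t ht).continuousWithinAt
  have hcl : EqOn c (fun _ => c ((a + b) / 2)) (Icc a b) := by
    have := hconst.of_subset_closure hcont continuousOn_const Ioo_subset_Icc_self
      (closure_Ioo hab.ne).symm.subset
    exact this
  exact (hcl (left_mem_Icc.2 hab.le)).trans (hcl (right_mem_Icc.2 hab.le)).symm

/-! ### One-parameter subgroups -/

section OneParameter

variable [CompleteSpace E] [BoundarylessManifold I G] [T2Space G]

theorem contMDiff_one_mulInvariantVectorField (X : GroupLieAlgebra I G) :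
    ContMDiff I I.tangent 1
      (fun g : G => (⟨g, mulInvariantVectorField X g⟩ : TangentBundle I G)) :=
  (contMDiff_mulInvariantVectorField X).of_le (by
      rw [minSmoothness_of_isRCLikeNormedField]; exact one_le_two)

theorem eq_of_isMIntegralCurve_mulInvariantVectorField {X : GroupLieAlgebra I G} {γ γ' : ℝ → G}
    (hγ : IsMIntegralCurve γ (mulInvariantVectorField X))
    (hγ' : IsMIntegralCurve γ' (mulInvariantVectorField X)) (h : γ 0 = γ' 0) : γ = γ' :=
  have : IsManifold I 1 G := IsManifold.of_le (n := ∞) (by simp)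
  isMIntegralCurve_Ioo_eq_of_contMDiff_boundaryless (t₀ := 0)
    (contMDiff_one_mulInvariantVectorField X) hγ hγ' h

/-- Each `lieExp (t • X)` comes from its own chosen integral curve. Uniqueness identifies that curve
with the curve of $X$ run at speed $t$, so all the choices fit together. -/
theorem isMIntegralCurve_lieExp_smul (X : GroupLieAlgebra I G) :
    IsMIntegralCurve (fun t : ℝ => (lieExp (t • X) : G)) (mulInvariantVectorField X) := by
  obtain ⟨h0, h⟩ := (exists_isMIntegralCurve_mulInvariantVectorField X).choose_spec
  set γ := (exists_isMIntegralCurve_mulInvariantVectorField X).choose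
  convert h using 1
  ext t
  obtain ⟨h0', h'⟩ := (exists_isMIntegralCurve_mulInvariantVectorField (t • X)).choose_spec
  have := h.comp_mul t
  rw [← mulInvariantVectorField_smul] at this
  have heq := eq_of_isMIntegralCurve_mulInvariantVectorField h' this (by simp [h0, h0'])
  have h1 := congrFun heq 1
  rw [Function.comp_apply, one_mul] at h1
  exact h1

theorem lieExp_zero : (lieExp (0 : GroupLieAlgebra I G) : G) = 1 := by
  obtain ⟨h0', h'⟩ := (exists_isMIntegralCurve_mulInvariantVectorField
    (0 : GroupLieAlgebra I G)).choose_spec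
  have hc : IsMIntegralCurve (fun _ : ℝ => (1 : G))
      (mulInvariantVectorField (0 : GroupLieAlgebra I G)) :=
    isMIntegralCurve_const (map_zero (leftDeriv I (1 : G) 1))
  exact congrFun (eq_of_isMIntegralCurve_mulInvariantVectorField h' hc h0') 1

theorem hasVelocityWithinAt_lieExp_smul (X : GroupLieAlgebra I G) (s : Set ℝ) (t : ℝ) :
    HasVelocityWithinAt I (fun t : ℝ => (lieExp (t • X) : G))
      (leftDeriv I (lieExp (t • X) : G) 1 X) s t :=
  (isMIntegralCurve_lieExp_smul X t).hasMFDerivWithinAt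

/-- As functions of $t$, both sides are integral curves of the same left-invariant field with the
same value at 0: one is a time shift, the other a left translate. -/
theorem lieExp_add_smul (X : GroupLieAlgebra I G) (s t : ℝ) :
    (lieExp ((s + t) • X) : G) = lieExp (s • X) * lieExp (t • X) := by
  have h1 := (isMIntegralCurve_lieExp_smul X).comp_add s
  have h2 : IsMIntegralCurve (fun t : ℝ => (lieExp (s • X) * lieExp (t • X) : G))
      (mulInvariantVectorField X) := by
    intro t
    have h := (mdifferentiable_mul_left' (I := I) (lieExp (s • X) : G)
      (lieExp (t • X))).hasMFDerivAt.comp t (isMIntegralCurve_lieExp_smul X t)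
    have h' : HasVelocityWithinAt I (fun t : ℝ => (lieExp (s • X) * lieExp (t • X) : G))
        (leftDeriv I (lieExp (s • X) * lieExp (t • X) : G) 1 X) univ t := by
      refine HasMFDerivWithinAt.hasVelocityWithinAt h.hasMFDerivWithinAt ?_
      rw [leftDeriv_mul, mul_one]
      change leftDeriv I (lieExp (s • X) : G) (lieExp (t • X))
        ((1 : ℝ) • leftDeriv I (lieExp (t • X) : G) 1 X) = _
      rw [one_smul]
      rfl
    exact HasMFDerivWithinAt.hasMFDerivAt h' Filter.univ_mem
  have := congrFun (eq_of_isMIntegralCurve_mulInvariantVectorField h1 h2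
    (by simp [lieExp_zero])) t
  simpa [add_comm] using this

theorem lieExp_nsmul (X : GroupLieAlgebra I G) (n : ℕ) :
    (lieExp ((n : ℝ) • X) : G) = lieExp X ^ n := by
  induction n with
  | zero => simp [lieExp_zero]
  | succ n ih =>
    have := lieExp_add_smul X (n : ℝ) 1
    rw [one_smul] at this
    rw [Nat.cast_succ, this, ih, pow_succ]

/-- From $e^{uX}=e^{(u-t)X}e^{tX}$, differentiated at $u=t$, only the velocity at the identity and a
right translation enter. -/
theorem hasRightVelocityWithinAt_lieExp_smul (X : GroupLieAlgebra I G) (s : Set ℝ) (t : ℝ) :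
    HasRightVelocityWithinAt I (fun t : ℝ => (lieExp (t • X) : G)) X s t := by
  set g : G := lieExp (t • X) with hg
  have h0 := hasVelocityWithinAt_lieExp_smul X univ (t - t)
  rw [sub_self, zero_smul, lieExp_zero, leftDeriv_one] at h0
  have h1 : HasVelocityWithinAt I (fun u : ℝ => (lieExp ((u - t) • X) : G)) ((1 : ℝ) • X) s t :=
    HasVelocityWithinAt.comp (f := fun u => u - t) (by simpa using h0)
      ((hasDerivWithinAt_id t s).sub_const t)
  have h2 : MDifferentiableAt I I (fun x : G => x * g) (lieExp ((t - t) • X)) :=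
    mdifferentiable_mul_right' g _
  have h := h2.hasMFDerivAt.comp_hasMFDerivWithinAt t h1
  have hfun : (fun x : G => x * g) ∘ (fun u : ℝ => (lieExp ((u - t) • X) : G)) =
      fun u : ℝ => (lieExp (u • X) : G) := by
    ext u
    simp only [Function.comp_apply, hg]
    rw [← lieExp_add_smul, sub_add_cancel]
  rw [hfun] at h
  refine HasMFDerivWithinAt.hasVelocityWithinAt h ?_
  change rightDeriv I g (lieExp ((t - t) • X)) ((1 : ℝ) • (1 : ℝ) • X) = rightDeriv I g 1 X
  rw [sub_self, zero_smul, lieExp_zero, one_smul, one_smul]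

/-- A curve through the identity with constant right velocity is a one-parameter subgroup. -/
theorem eq_lieExp_of_hasRightVelocityWithinAt {c : ℝ → G} {Y : GroupLieAlgebra I G} (h0 : c 0 = 1)
    (h : ∀ t ∈ Icc (0 : ℝ) 1, HasRightVelocityWithinAt I c Y (Icc 0 1) t) : c 1 = lieExp Y := by
  -- The curve $e^{-uY}c(u)$ is stationary: the two terms of the product rule cancel because left
  -- and right translations commute.
  have hv : ∀ t ∈ Icc (0 : ℝ) 1, HasVelocityWithinAt I
      (fun u => (lieExp ((-u) • Y) : G) * c u) 0 (Icc 0 1) t := by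
    intro t ht
    have h1 := HasVelocityWithinAt.comp (f := fun u => -u) (f' := -1) (s := Icc 0 1) (t := t)
      (hasVelocityWithinAt_lieExp_smul Y univ (-t)) (hasDerivWithinAt_id t _).neg
    convert HasVelocityWithinAt.mul h1 (h t ht) using 1
    have h2 := leftDeriv_comp_rightDeriv (I := I) (lieExp ((-t) • Y)) (c t) 1
    rw [one_mul, mul_one] at h2
    have h3 : leftDeriv I (lieExp ((-t) • Y) : G) (c t) (rightDeriv I (c t) 1 Y) =
        rightDeriv I (c t) (lieExp ((-t) • Y)) (leftDeriv I (lieExp ((-t) • Y) : G) 1 Y) :=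
      DFunLike.congr_fun h2 Y
    rw [h3, map_smul, neg_one_smul, neg_add_cancel]
  have h2 := eq_of_hasVelocityWithinAt_zero zero_lt_one hv
  simp only [neg_zero, zero_smul, lieExp_zero, h0, mul_one] at h2
  have h3 := lieExp_add_smul Y 1 (-1)
  rw [add_neg_cancel, zero_smul, lieExp_zero, one_smul] at h3
  rw [← one_mul (c 1), h3, mul_assoc, ← h2, mul_one]

end OneParameter

end Translations

/-! ### Second-order calculus of a local group law -/

section LocalGroupLaw

open Topology

variable {E : Type*} [NormedAddCommGroup E] [NormedSpace ℝ E]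

/-- The partial derivative at `(x, e)` of a local group law in the second variable. -/
def partialRight (m : E × E → E) (e x : E) : E →L[ℝ] E :=
  (fderiv ℝ m (x, e)).comp (ContinuousLinearMap.inr ℝ E E)

/-- The partial derivative at `(e, x)` of a local group law in the first variable. -/
def partialLeft (m : E × E → E) (e x : E) : E →L[ℝ] E :=
  (fderiv ℝ m (e, x)).comp (ContinuousLinearMap.inl ℝ E E)

variable {m : E × E → E} {e : E}

theorem hasFDerivAt_partialRight (hm : ContDiffAt ℝ 2 m (e, e)) (w : E) :
    HasFDerivAt (fun x => partialRight m e x w)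
      (((fderiv ℝ (fderiv ℝ m) (e, e)).flip (0, w)).comp (ContinuousLinearMap.inl ℝ E E)) e := by
  have h1 : HasFDerivAt (fderiv ℝ m) (fderiv ℝ (fderiv ℝ m) (e, e)) (e, e) :=
    ((hm.fderiv_right (m := 1) (by norm_num)).differentiableAt (by simp)).hasFDerivAt
  have h2 : HasFDerivAt (fun x : E => (x, e)) (ContinuousLinearMap.inl ℝ E E) e :=
    hasFDerivAt_prodMk_left e e
  have h3 := (HasFDerivAt.comp (f := fun x : E => (x, e)) e h1 h2).clm_apply (hasFDerivAt_const ((0 : E), w) e)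
  convert h3 using 1
  · ext v
    simp [partialRight]
  · ext v
    simp

theorem hasFDerivAt_partialLeft (hm : ContDiffAt ℝ 2 m (e, e)) :
    HasFDerivAt (partialLeft m e)
      ((((ContinuousLinearMap.compL ℝ E (E × E) E).flip (ContinuousLinearMap.inl ℝ E E)).comp
        (fderiv ℝ (fderiv ℝ m) (e, e))).comp (ContinuousLinearMap.inr ℝ E E)) e := by
  have h1 : HasFDerivAt (fderiv ℝ m) (fderiv ℝ (fderiv ℝ m) (e, e)) (e, e) :=
    ((hm.fderiv_right (m := 1) (by norm_num)).differentiableAt (by simp)).hasFDerivAt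
  have h2 : HasFDerivAt (fun x : E => (e, x)) (ContinuousLinearMap.inr ℝ E E) e :=
    hasFDerivAt_prodMk_right e e
  exact ((ContinuousLinearMap.compL ℝ E (E × E) E).flip
    (ContinuousLinearMap.inl ℝ E E)).hasFDerivAt.comp e
    (HasFDerivAt.comp (f := fun x : E => (e, x)) e h1 h2)

/-- The derivative at the unit of the adjoint action of a local group law. -/
theorem hasDerivAt_of_partialLeft_eq_partialRight [CompleteSpace E]
    (hm : ContDiffAt ℝ 2 m (e, e))
    (hL : partialLeft m e e = ContinuousLinearMap.id ℝ E)
    (hR : partialRight m e e = ContinuousLinearMap.id ℝ E)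
    {ξ a : ℝ → E} {X Y : E} (h0 : ξ 0 = e) (hξ : HasDerivAt ξ X 0)
    (ha : ∀ᶠ t in 𝓝 0, partialLeft m e (ξ t) (a t) = partialRight m e (ξ t) Y) :
    HasDerivAt a (fderiv ℝ (fun x => partialRight m e x Y) e X -
      fderiv ℝ (fun x => partialRight m e x X) e Y) 0 := by
  -- Near 0, $a=L^{-1}RY$ with $L,R$ the left and right partials along $\xi$. Its derivative
  -- contains $-D^2m(0,X)(Y,0)$; symmetry of $D^2m$ turns this into minus the derivative of
  -- $x\mapsto\partial_2m(x,e)X$ along $Y$.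
  have hsymm : IsSymmSndFDerivAt ℝ m (e, e) := hm.isSymmSndFDerivAt (by simp)
  have h1 : HasDerivAt (fun t => partialLeft m e (ξ t)) _ 0 :=
    HasFDerivAt.comp_hasDerivAt (0 : ℝ) (f := ξ) (l := partialLeft m e)
      (by rw [h0]; exact hasFDerivAt_partialLeft hm) hξ
  have h2 : HasDerivAt (fun t => partialRight m e (ξ t) Y) _ 0 :=
    HasFDerivAt.comp_hasDerivAt (0 : ℝ) (f := ξ) (l := fun x => partialRight m e x Y)
      (by rw [h0]; exact hasFDerivAt_partialRight hm Y) hξ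
  have hone : partialLeft m e (ξ 0) = ((1 : (E →L[ℝ] E)ˣ) : E →L[ℝ] E) := by
    rw [h0, hL]; rfl
  have h3 : HasDerivAt (fun t => Ring.inverse (partialLeft m e (ξ t))) _ 0 :=
    HasFDerivAt.comp_hasDerivAt (0 : ℝ) (f := fun t => partialLeft m e (ξ t))
      (l := Ring.inverse) (by rw [hone]; exact hasFDerivAt_ringInverse (1 : (E →L[ℝ] E)ˣ)) h1
  have h4 := h3.clm_apply h2
  -- Invertible operators form an open set, so $L$ stays invertible near the identity and the
  -- equation in `ha` can be solved for $a$.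
  have hunit : ∀ᶠ t in 𝓝 0, IsUnit (partialLeft m e (ξ t)) := by
    have := h1.continuousAt.eventually_mem (Units.isOpen.mem_nhds (by rw [hone]; exact Units.isUnit _))
    exact this
  have hev : a =ᶠ[𝓝 0] fun t => Ring.inverse (partialLeft m e (ξ t)) (partialRight m e (ξ t) Y) := by
    filter_upwards [ha, hunit] with t ht hu
    rw [← ht]
    exact (DFunLike.congr_fun (Ring.inverse_mul_cancel _ hu) (a t)).symm
  refine HasDerivAt.congr_of_eventuallyEq ?_ hev
  convert! h4 using 1
  rw [(hasFDerivAt_partialRight hm Y).fderiv, (hasFDerivAt_partialRight hm X).fderiv, hone, h0, hR,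
    Ring.inverse_unit]
  have := hsymm (Y, 0) (0, X)
  simp [this]
  abel

end LocalGroupLaw

/-! ### The derivative of Ad is the Lie bracket -/

section Adjoint

open Topology VectorField

variable {E : Type*} [NormedAddCommGroup E] [NormedSpace ℝ E]
  {H : Type*} [TopologicalSpace H] (I : ModelWithCorners ℝ E H)
  (G : Type*) [TopologicalSpace G] [ChartedSpace H G] [Group G]

/-- The multiplication of a Lie group in the extended chart at the identity. -/
def mulInChart (p : E × E) : E :=
  extChartAt I (1 : G) ((extChartAt I (1 : G)).symm p.1 * (extChartAt I (1 : G)).symm p.2)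

/-- The derivative of the extended chart at the identity. -/
def chartDeriv {G : Type*} [TopologicalSpace G] [ChartedSpace H G] [Group G] (g : G) : E →L[ℝ] E :=
  mfderiv I 𝓘(ℝ, E) (extChartAt I (1 : G)) g

theorem chartDeriv_one [IsManifold I 1 G] : chartDeriv I (1 : G) = ContinuousLinearMap.id ℝ E :=
  mfderiv_extChartAt_self

variable {I G} [LieGroup I ∞ G] [I.Boundaryless]

theorem hasMFDerivAt_extChartAt_one {g : G} (hg : g ∈ (extChartAt I (1 : G)).source) :
    HasMFDerivAt I 𝓘(ℝ, E) (extChartAt I (1 : G)) g (chartDeriv I g : E →L[ℝ] E) :=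
  have : IsManifold I 1 G := IsManifold.of_le (n := ∞) (by simp)
  (mdifferentiableAt_extChartAt (by simpa using hg)).hasMFDerivAt

variable (I G) in
theorem hasMFDerivAt_extChartAt_one_symm :
    HasMFDerivAt 𝓘(ℝ, E) I (extChartAt I (1 : G)).symm (extChartAt I (1 : G) 1)
      (ContinuousLinearMap.id ℝ E) := by
  have : IsManifold I 1 G := IsManifold.of_le (n := ∞) (by simp)
  have h := (mdifferentiableWithinAt_extChartAt_symm (I := I)
    (mem_extChartAt_target (I := I) (1 : G))).hasMFDerivWithinAt
  rw [mfderivWithin_range_extChartAt_symm, I.range_eq_univ] at h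
  exact h.hasMFDerivAt Filter.univ_mem

variable (I G) in
theorem contDiffAt_mulInChart :
    ContDiffAt ℝ 2 (mulInChart I G) (extChartAt I (1 : G) 1, extChartAt I (1 : G) 1) := by
  have : IsManifold I 2 G := IsManifold.of_le (n := ∞) ENat.LEInfty.out
  rw [← contMDiffAt_iff_contDiffAt]
  have h : ContMDiffAt 𝓘(ℝ, E) I 2 (extChartAt I (1 : G)).symm (extChartAt I (1 : G) 1) :=
    (contMDiffOn_extChartAt_symm (1 : G)).contMDiffAt (extChartAt_target_mem_nhds (1 : G))
  have h1 : ContMDiffAt 𝓘(ℝ, E × E) I 2 (fun p : E × E => (extChartAt I (1 : G)).symm p.1)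
      (extChartAt I (1 : G) 1, extChartAt I (1 : G) 1) :=
    ContMDiffAt.comp (I' := 𝓘(ℝ, E)) (extChartAt I (1 : G) 1, extChartAt I (1 : G) 1) h
      contDiff_fst.contMDiff.contMDiffAt
  have h2 : ContMDiffAt 𝓘(ℝ, E × E) I 2 (fun p : E × E => (extChartAt I (1 : G)).symm p.2)
      (extChartAt I (1 : G) 1, extChartAt I (1 : G) 1) :=
    ContMDiffAt.comp (I' := 𝓘(ℝ, E)) (extChartAt I (1 : G) 1, extChartAt I (1 : G) 1) h
      contDiff_snd.contMDiff.contMDiffAt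
  have : LieGroup I 2 G := LieGroup.of_le (n := ∞) ENat.LEInfty.out
  have h3 := h1.mul h2
  refine ContMDiffAt.comp (I' := I) _ ?_ h3
  simpa using contMDiffAt_extChartAt (I := I) (n := 2) (x := (1 : G))

variable (I G) in
theorem eventually_differentiableAt_mulInChart :
    ∀ᶠ p in 𝓝 (extChartAt I (1 : G) 1, extChartAt I (1 : G) 1),
      DifferentiableAt ℝ (mulInChart I G) p := by
  filter_upwards [(contDiffAt_mulInChart I G).eventually (by simp)] with p hp
  exact hp.differentiableAt (by simp)

theorem partialRight_mulInChart {x : E}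
    (hx : x ∈ (extChartAt I (1 : G)).target)
    (hd : DifferentiableAt ℝ (mulInChart I G) (x, extChartAt I (1 : G) 1)) :
    partialRight (mulInChart I G) (extChartAt I (1 : G) 1) x =
      (chartDeriv I ((extChartAt I (1 : G)).symm x)).comp
        (leftDeriv I ((extChartAt I (1 : G)).symm x) 1) := by
  have : IsManifold I 1 G := IsManifold.of_le (n := ∞) (by simp)
  set g := (extChartAt I (1 : G)).symm x with hg
  have hgs : g ∈ (extChartAt I (1 : G)).source := (extChartAt I (1 : G)).map_target hx
  have h1 := hasMFDerivAt_extChartAt_one_symm I G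
  have h2 : HasMFDerivAt I I (fun y : G => g * y)
      ((extChartAt I (1 : G)).symm (extChartAt I (1 : G) 1)) (leftDeriv I g 1 : E →L[ℝ] E) := by
    rw [extChartAt_to_inv]
    exact (mdifferentiable_mul_left' g 1).hasMFDerivAt
  have h3 : HasMFDerivAt I 𝓘(ℝ, E) (extChartAt I (1 : G))
      (g * (extChartAt I (1 : G)).symm (extChartAt I (1 : G) 1)) (chartDeriv I g : E →L[ℝ] E) := by
    rw [extChartAt_to_inv, mul_one]
    exact hasMFDerivAt_extChartAt_one hgs
  have h4 : HasFDerivAt (fun y => mulInChart I G (x, y))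
      ((chartDeriv I g).comp ((leftDeriv I g 1).comp (ContinuousLinearMap.id ℝ E)))
      (extChartAt I (1 : G) 1) :=
    (HasMFDerivAt.comp (extChartAt I (1 : G) 1) h3
      (HasMFDerivAt.comp (extChartAt I (1 : G) 1) h2 h1)).hasFDerivAt
  exact (hd.hasFDerivAt.comp _ (hasFDerivAt_prodMk_right x _)).unique h4

theorem partialLeft_mulInChart {x : E}
    (hx : x ∈ (extChartAt I (1 : G)).target)
    (hd : DifferentiableAt ℝ (mulInChart I G) (extChartAt I (1 : G) 1, x)) :
    partialLeft (mulInChart I G) (extChartAt I (1 : G) 1) x =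
      (chartDeriv I ((extChartAt I (1 : G)).symm x)).comp
        (rightDeriv I ((extChartAt I (1 : G)).symm x) 1) := by
  have : IsManifold I 1 G := IsManifold.of_le (n := ∞) (by simp)
  set g := (extChartAt I (1 : G)).symm x with hg
  have hgs : g ∈ (extChartAt I (1 : G)).source := (extChartAt I (1 : G)).map_target hx
  have h1 := hasMFDerivAt_extChartAt_one_symm I G
  have h2 : HasMFDerivAt I I (fun y : G => y * g)
      ((extChartAt I (1 : G)).symm (extChartAt I (1 : G) 1)) (rightDeriv I g 1 : E →L[ℝ] E) := by
    rw [extChartAt_to_inv]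
    exact (mdifferentiable_mul_right' g 1).hasMFDerivAt
  have h3 : HasMFDerivAt I 𝓘(ℝ, E) (extChartAt I (1 : G))
      ((extChartAt I (1 : G)).symm (extChartAt I (1 : G) 1) * g) (chartDeriv I g : E →L[ℝ] E) := by
    rw [extChartAt_to_inv, one_mul]
    exact hasMFDerivAt_extChartAt_one hgs
  have h4 : HasFDerivAt (fun y => mulInChart I G (y, x))
      ((chartDeriv I g).comp ((rightDeriv I g 1).comp (ContinuousLinearMap.id ℝ E)))
      (extChartAt I (1 : G) 1) :=
    (HasMFDerivAt.comp (extChartAt I (1 : G) 1) h3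
      (HasMFDerivAt.comp (extChartAt I (1 : G) 1) h2 h1)).hasFDerivAt
  exact (HasFDerivAt.comp (f := fun y : E => (y, x)) _ hd.hasFDerivAt
    (hasFDerivAt_prodMk_left _ x)).unique h4

/-- This turns left-invariant fields into the partial derivatives of the local group law to which
the calculus above applies. -/
theorem mpullbackWithin_mulInvariantVectorField (v : GroupLieAlgebra I G)
    {x : E} (hx : x ∈ (extChartAt I (1 : G)).target)
    (hd : DifferentiableAt ℝ (mulInChart I G) (x, extChartAt I (1 : G) 1)) :
    mpullbackWithin 𝓘(ℝ, E) I (extChartAt I (1 : G)).symm (mulInvariantVectorField v) (range I) x =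
      partialRight (mulInChart I G) (extChartAt I (1 : G) 1) x v := by
  have : IsManifold I 1 G := IsManifold.of_le (n := ∞) (by simp)
  rw [partialRight_mulInChart hx hd, mpullbackWithin_apply,
    ContinuousLinearMap.inverse_eq
      (mfderivWithin_extChartAt_symm_comp_mfderiv_extChartAt hx)
      (mfderiv_extChartAt_comp_mfderivWithin_extChartAt_symm hx)]
  rfl

/-- The bracket on the Lie algebra is that of left-invariant fields at 1. It is computed in the
chart at 1, whose derivative there is the identity, as is $\partial_2m(e,e)$. -/
theorem bracket_eq_fderiv_partialRight (v w : GroupLieAlgebra I G) :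
    (⁅v, w⁆ : GroupLieAlgebra I G) =
      (fderiv ℝ (fun x => partialRight (mulInChart I G) (extChartAt I (1 : G) 1) x w)
        (extChartAt I (1 : G) 1) v -
      fderiv ℝ (fun x => partialRight (mulInChart I G) (extChartAt I (1 : G) 1) x v)
        (extChartAt I (1 : G) 1) w : E) := by
  have : IsManifold I 1 G := IsManifold.of_le (n := ∞) (by simp)
  have hev : ∀ v : GroupLieAlgebra I G,
      mpullbackWithin 𝓘(ℝ, E) I (extChartAt I (1 : G)).symm (mulInvariantVectorField v) (range I)
        =ᶠ[𝓝 (extChartAt I (1 : G) 1)]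
        fun x => partialRight (mulInChart I G) (extChartAt I (1 : G) 1) x v := by
    intro v
    have hc : Filter.Tendsto (fun x : E => (x, extChartAt I (1 : G) 1))
        (𝓝 (extChartAt I (1 : G) 1)) (𝓝 (extChartAt I (1 : G) 1, extChartAt I (1 : G) 1)) :=
      (Continuous.prodMk_left (extChartAt I (1 : G) 1)).tendsto _
    filter_upwards [extChartAt_target_mem_nhds (I := I) (1 : G),
      hc.eventually (eventually_differentiableAt_mulInChart I G)] with x hx hd
    exact mpullbackWithin_mulInvariantVectorField v hx hd
  have hid : partialRight (mulInChart I G) (extChartAt I (1 : G) 1) (extChartAt I (1 : G) 1) =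
      ContinuousLinearMap.id ℝ E := by
    rw [partialRight_mulInChart (mem_extChartAt_target (1 : G))
      ((contDiffAt_mulInChart I G).differentiableAt (by simp)), extChartAt_to_inv, leftDeriv_one,
      chartDeriv_one]
    rfl
  have hb : (⁅v, w⁆ : GroupLieAlgebra I G) =
      (chartDeriv I (1 : G)).inverse
        (lieBracketWithin (E := E) ℝ
          (mpullbackWithin 𝓘(ℝ, E) I (extChartAt I (1 : G)).symm (mulInvariantVectorField v)
            (range I))
          (mpullbackWithin 𝓘(ℝ, E) I (extChartAt I (1 : G)).symm (mulInvariantVectorField w)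
            (range I)) ((extChartAt I (1 : G)).symm ⁻¹' univ ∩ range I) (extChartAt I (1 : G) 1)) :=
    rfl
  have hset : (extChartAt I (1 : G)).symm ⁻¹' univ ∩ range I = univ := by
    rw [I.range_eq_univ, preimage_univ, univ_inter]
  have key : ∀ V W : E → E,
      V =ᶠ[𝓝 (extChartAt I (1 : G) 1)]
        (fun x => partialRight (mulInChart I G) (extChartAt I (1 : G) 1) x v) →
      W =ᶠ[𝓝 (extChartAt I (1 : G) 1)]
        (fun x => partialRight (mulInChart I G) (extChartAt I (1 : G) 1) x w) →
      lieBracketWithin ℝ V W univ (extChartAt I (1 : G) 1) =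
      (fderiv ℝ (fun x => partialRight (mulInChart I G) (extChartAt I (1 : G) 1) x w)
        (extChartAt I (1 : G) 1) v -
      fderiv ℝ (fun x => partialRight (mulInChart I G) (extChartAt I (1 : G) 1) x v)
        (extChartAt I (1 : G) 1) w : E) := by
    intro V W hV hW
    rw [lieBracketWithin_univ, hV.lieBracket_vectorField_eq hW, lieBracket_eq]
    simp only [hid]
    rfl
  rw [hb, chartDeriv_one, ContinuousLinearMap.inverse_id, hset]
  exact key _ _ (hev v) (hev w)

variable [CompleteSpace E] [T2Space G]

theorem hasDerivAt_extChartAt_lieExp_smul (X : GroupLieAlgebra I G) :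
    HasDerivAt (fun t : ℝ => extChartAt I (1 : G) (lieExp (t • X))) (X : E) 0 := by
  have : IsManifold I 1 G := IsManifold.of_le (n := ∞) (by simp)
  have h1 := hasVelocityWithinAt_lieExp_smul X univ 0
  rw [zero_smul, lieExp_zero, leftDeriv_one] at h1
  have h2 : HasMFDerivAt I 𝓘(ℝ, E) (extChartAt I (1 : G)) (lieExp ((0 : ℝ) • X))
      (ContinuousLinearMap.id ℝ E : E →L[ℝ] E) := by
    rw [zero_smul, lieExp_zero, ← chartDeriv_one I (G := G)]
    exact hasMFDerivAt_extChartAt_one (mem_extChartAt_source (1 : G))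
  have h3 : HasFDerivAt (fun t : ℝ => extChartAt I (1 : G) (lieExp (t • X)))
      ((ContinuousLinearMap.id ℝ E).comp (ContinuousLinearMap.smulRight (1 : ℝ →L[ℝ] ℝ) (X : E)))
      (0 : ℝ) :=
    (HasMFDerivAt.comp (0 : ℝ) h2 (HasMFDerivWithinAt.hasMFDerivAt h1 Filter.univ_mem)).hasFDerivAt
  exact h3.hasDerivAt.congr_deriv (one_smul ℝ (X : E))

/-- The derivative of the adjoint representation at the identity is the Lie bracket. -/
theorem hasDerivAt_groupAd_lieExp_smul_zero (X Y : GroupLieAlgebra I G) :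
    HasDerivAt (fun t : ℝ => groupAd I (lieExp (t • X) : G) Y) (⁅X, Y⁆ : GroupLieAlgebra I G) 0 := by
  have : IsManifold I 1 G := IsManifold.of_le (n := ∞) (by simp)
  have hm := contDiffAt_mulInChart I G
  have h0 : extChartAt I (1 : G) (lieExp ((0 : ℝ) • X)) = extChartAt I (1 : G) 1 := by
    rw [zero_smul, lieExp_zero]
  have hξ := hasDerivAt_extChartAt_lieExp_smul X
  have hR : partialRight (mulInChart I G) (extChartAt I (1 : G) 1) (extChartAt I (1 : G) 1) =
      ContinuousLinearMap.id ℝ E := by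
    rw [partialRight_mulInChart (mem_extChartAt_target (1 : G))
      (hm.differentiableAt (by simp)), extChartAt_to_inv, leftDeriv_one, chartDeriv_one]
    rfl
  have hL : partialLeft (mulInChart I G) (extChartAt I (1 : G) 1) (extChartAt I (1 : G) 1) =
      ContinuousLinearMap.id ℝ E := by
    rw [partialLeft_mulInChart (mem_extChartAt_target (1 : G))
      (hm.differentiableAt (by simp)), extChartAt_to_inv, rightDeriv_one, chartDeriv_one]
    rfl
  rw [bracket_eq_fderiv_partialRight X Y]
  -- What remains is the relation between `groupAd` and the two translations, pushed through the
  -- chart derivative at points near 1.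
  refine hasDerivAt_of_partialLeft_eq_partialRight hm hL hR h0 hξ ?_
  have hc1 : Filter.Tendsto (fun t : ℝ => extChartAt I (1 : G) (lieExp (t • X)))
      (𝓝 0) (𝓝 (extChartAt I (1 : G) 1)) := h0 ▸ hξ.continuousAt.tendsto
  have hc2 : Filter.Tendsto (fun t : ℝ => (lieExp (t • X) : G)) (𝓝 0) (𝓝 1) := by
    have h := (isMIntegralCurve_lieExp_smul X).continuous.tendsto 0
    rwa [zero_smul, lieExp_zero] at h
  filter_upwards [hc2.eventually_mem (extChartAt_source_mem_nhds (I := I) (1 : G)),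
    (hc1.prodMk_nhds tendsto_const_nhds).eventually (eventually_differentiableAt_mulInChart I G),
    (tendsto_const_nhds.prodMk_nhds hc1).eventually (eventually_differentiableAt_mulInChart I G)]
    with t hs hd1 hd2
  have ht := (extChartAt I (1 : G)).map_source hs
  rw [partialLeft_mulInChart ht hd2, partialRight_mulInChart ht hd1,
    (extChartAt I (1 : G)).left_inv hs]
  exact congrArg (chartDeriv I (lieExp (t • X) : G)) (rightDeriv_groupAd _ _)

/-- Multiplicativity of Ad along $e^{tX}=e^{sX}e^{(t-s)X}$ carries the derivative at 0 to time $s$.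
-/
theorem hasDerivAt_groupAd_lieExp_smul (X Y : GroupLieAlgebra I G) (s : ℝ) :
    HasDerivAt (fun t : ℝ => groupAd I (lieExp (t • X) : G) Y)
      (groupAd I (lieExp (s • X) : G) (⁅X, Y⁆ : GroupLieAlgebra I G)) s := by
  have h1 : HasDerivAt (fun t : ℝ => groupAd I (lieExp ((t - s) • X) : G) Y)
      (⁅X, Y⁆ : GroupLieAlgebra I G) s := by
    have h := hasDerivAt_groupAd_lieExp_smul_zero X Y
    rw [← sub_self s] at h
    exact HasDerivAt.comp_sub_const s s h
  have h2 := (groupAd I (lieExp (s • X) : G)).hasFDerivAt.comp_hasDerivAt s h1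
  convert h2 using 1
  ext t
  have h3 := groupAd_mul (I := I) (lieExp (s • X) : G) (lieExp ((t - s) • X))
  rw [← lieExp_add_smul, add_sub_cancel] at h3
  exact DFunLike.congr_fun h3 Y

end Adjoint

/-! ### The adjoint representation in coordinates -/

section AdjointMatrix

variable {E : Type*} [NormedAddCommGroup E] [NormedSpace ℝ E]
  {H : Type*} [TopologicalSpace H] {I : ModelWithCorners ℝ E H}
  {G : Type*} [TopologicalSpace G] [ChartedSpace H G] [Group G] {N : ℕ}

/-- The matrix of the adjoint action of a group element. -/
def groupAdMatrix (b : Module.Basis (Fin N) ℝ (GroupLieAlgebra I G)) (g : G) :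
    Matrix (Fin N) (Fin N) ℝ :=
  LinearMap.toMatrix b b
    ((groupAd I g).toLinearMap : GroupLieAlgebra I G →ₗ[ℝ] GroupLieAlgebra I G)

variable [LieGroup I ∞ G] (b : Module.Basis (Fin N) ℝ (GroupLieAlgebra I G))

theorem groupAdMatrix_apply (g : G) (i j : Fin N) :
    groupAdMatrix b g i j = b.repr (groupAd I g (b j) : GroupLieAlgebra I G) i :=
  LinearMap.toMatrix_apply _ _ _ _ _

theorem groupAdMatrix_one : groupAdMatrix b (1 : G) = 1 := by
  unfold groupAdMatrix
  rw [groupAd_one]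
  exact LinearMap.toMatrix_id b

theorem groupAdMatrix_mul (g h : G) :
    groupAdMatrix b (g * h) = groupAdMatrix b g * groupAdMatrix b h := by
  unfold groupAdMatrix
  rw [groupAd_mul]
  exact LinearMap.toMatrix_comp b b b _ _

variable [I.Boundaryless] [CompleteSpace E] [T2Space G]

theorem hasDerivAt_groupAdMatrix_lieExp_smul (X : GroupLieAlgebra I G) (s : ℝ) (i j : Fin N) :
    HasDerivAt (fun t : ℝ => groupAdMatrix b (lieExp (t • X) : G) i j)
      ((groupAdMatrix b (lieExp (s • X) : G) *
        LinearMap.toMatrix b b (LieAlgebra.ad ℝ (GroupLieAlgebra I G) X :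
          GroupLieAlgebra I G →ₗ[ℝ] GroupLieAlgebra I G)) i j) s := by
  -- Finite dimension makes the coordinate functionals continuous, so they commute with
  -- differentiation.
  have hfin : FiniteDimensional ℝ E := Module.Basis.finiteDimensional_of_finite (ι := Fin N) b
  let c : E →L[ℝ] ℝ := LinearMap.toContinuousLinearMap (b.coord i : E →ₗ[ℝ] ℝ)
  have h := c.hasFDerivAt.comp_hasDerivAt s (hasDerivAt_groupAd_lieExp_smul X (b j) s)
  have hmat : groupAdMatrix b (lieExp (s • X) : G) *
        LinearMap.toMatrix b b (LieAlgebra.ad ℝ (GroupLieAlgebra I G) X :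
          GroupLieAlgebra I G →ₗ[ℝ] GroupLieAlgebra I G) =
      LinearMap.toMatrix b b
        (((groupAd I (lieExp (s • X) : G)).toLinearMap :
            GroupLieAlgebra I G →ₗ[ℝ] GroupLieAlgebra I G) ∘ₗ
          (LieAlgebra.ad ℝ (GroupLieAlgebra I G) X :
            GroupLieAlgebra I G →ₗ[ℝ] GroupLieAlgebra I G)) :=
    (LinearMap.toMatrix_comp b b b _ _).symm
  rw [hmat, LinearMap.toMatrix_apply]
  convert! h using 1
  ext t
  exact groupAdMatrix_apply b _ i j

end AdjointMatrix

/-! ### A linear matrix differential equation -/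

section MatrixODE

attribute [local instance] Matrix.linftyOpNormedRing Matrix.linftyOpNormedAlgebra
  Matrix.linftyOpNormedAddCommGroup Matrix.linftyOpNormedSpace

/-- A matrix curve with `A' = A D` and `A 0 = 1` is the exponential. -/
theorem eq_exp_of_hasDerivAt_mul {N : ℕ} {A : ℝ → Matrix (Fin N) (Fin N) ℝ}
    {D : Matrix (Fin N) (Fin N) ℝ} (h0 : A 0 = 1)
    (h : ∀ s i j, HasDerivAt (fun t => A t i j) ((A s * D) i j) s) (s : ℝ) :
    A s = NormedSpace.exp (s • D) := by
  have hA : ∀ s, HasDerivAt A (A s * D) s := fun s =>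
    hasDerivAt_pi.2 fun i => hasDerivAt_pi.2 fun j => h s i j
  -- The product $A(t)e^{-tD}$ has zero derivative, hence keeps its initial value 1.
  have hF : ∀ s, HasDerivAt (fun t => A t * NormedSpace.exp (t • -D)) 0 s := by
    intro s
    convert! (hA s).mul (hasDerivAt_exp_smul_const' (𝕂 := ℝ) (-D) s) using 1
    noncomm_ring
  have hc := is_const_of_deriv_eq_zero (fun s => (hF s).differentiableAt)
    (fun s => (hF s).deriv) s 0
  simp only [h0, zero_smul, NormedSpace.exp_zero, mul_one] at hc
  rw [smul_neg, Matrix.exp_neg] at hc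
  have hu := (Matrix.isUnit_iff_isUnit_det _).1 (Matrix.isUnit_exp (s • D))
  calc A s = A s * (NormedSpace.exp (s • D))⁻¹ * NormedSpace.exp (s • D) :=
        (Matrix.nonsing_inv_mul_cancel_right _ _ hu).symm
    _ = _ := by rw [hc, one_mul]

end MatrixODE

/-! ### From Wei–Norman solutions to canonical coordinates of the second kind -/

section Solution

variable {E : Type*} [NormedAddCommGroup E] [NormedSpace ℝ E]
  {H : Type*} [TopologicalSpace H] {I : ModelWithCorners ℝ E H} [I.Boundaryless] [CompleteSpace E]
  {G : Type*} [TopologicalSpace G] [ChartedSpace H G] [Group G] [LieGroup I ∞ G] [T2Space G]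
  {N : ℕ} (b : Module.Basis (Fin N) ℝ (GroupLieAlgebra I G))

theorem groupAdMatrix_lieExp_smul (k : Fin N) (s : ℝ) :
    groupAdMatrix b (lieExp (s • b k) : G) = expAdMatrix b k s :=
  eq_exp_of_hasDerivAt_mul (A := fun s => groupAdMatrix b (lieExp (s • b k) : G))
    (by rw [zero_smul, lieExp_zero, groupAdMatrix_one])
    (hasDerivAt_groupAdMatrix_lieExp_smul b (b k)) s

theorem groupAdMatrix_list_prod (l : List (Fin N)) (τ : Fin N → ℝ) :
    groupAdMatrix b ((l.map fun k => (lieExp (τ k • b k) : G)).prod) =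
      (l.map fun k => expAdMatrix b k (τ k)).prod := by
  induction l with
  | nil => simp [groupAdMatrix_one]
  | cons k l ih =>
    simp only [List.map_cons, List.prod_cons]
    rw [groupAdMatrix_mul, ih, groupAdMatrix_lieExp_smul]

/-- Induction on the length of the prefix: by the product rule, each new factor contributes its
velocity transformed by Ad of the preceding partial product. Beyond $N$ factors the prefix no longer
changes. -/
theorem hasRightVelocityWithinAt_list_prod {τ : ℝ → Fin N → ℝ} {η : Fin N → ℝ} {s : Set ℝ} {t : ℝ}
    (hτ : HasDerivWithinAt τ η s t) (n : ℕ) :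
    HasRightVelocityWithinAt I
      (fun u => (((List.finRange N).take n).map fun k => (lieExp (τ u k • b k) : G)).prod)
      (((List.finRange N).take n).map fun j => (η j • groupAd I
        (((List.finRange N).take j).map fun k => (lieExp (τ t k • b k) : G)).prod (b j) : E)).sum
      s t := by
  induction n with
  | zero =>
    simp only [List.take_zero, List.map_nil, List.prod_nil, List.sum_nil]
    exact hasRightVelocityWithinAt_one s t
  | succ n ih =>
    by_cases hn : n < N
    · have hlt : n < (List.finRange N).length := by simpa using hn
      have htake : (List.finRange N).take (n + 1) = (List.finRange N).take n ++ [⟨n, hn⟩] := by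
        rw [List.take_succ_eq_append_getElem hlt]
        simp
      have h1 : HasRightVelocityWithinAt I (fun u => (lieExp (τ u ⟨n, hn⟩ • b ⟨n, hn⟩) : G))
          (η ⟨n, hn⟩ • (b ⟨n, hn⟩ : E)) s t :=
        HasRightVelocityWithinAt.comp (a := fun r : ℝ => (lieExp (r • b ⟨n, hn⟩) : G))
          (f := fun u => τ u ⟨n, hn⟩)
          (hasRightVelocityWithinAt_lieExp_smul (b ⟨n, hn⟩) univ (τ t ⟨n, hn⟩))
          (hasDerivWithinAt_pi.1 hτ ⟨n, hn⟩)
      have h2 := HasRightVelocityWithinAt.mul ih h1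
      have hsum : (((List.finRange N).take (n + 1)).map fun j => (η j • groupAd I
          (((List.finRange N).take j).map fun k => (lieExp (τ t k • b k) : G)).prod (b j) :
            E)).sum = (((List.finRange N).take n).map fun j => (η j • groupAd I
          (((List.finRange N).take j).map fun k => (lieExp (τ t k • b k) : G)).prod (b j) :
            E)).sum + groupAd I (((List.finRange N).take n).map
              fun k => (lieExp (τ t k • b k) : G)).prod (η ⟨n, hn⟩ • (b ⟨n, hn⟩ : E)) := by
        rw [htake, List.map_append, List.sum_append, List.map_singleton, List.sum_singleton]
        exact congrArg _ (map_smul (groupAd I _) _ (b ⟨n, hn⟩ : E)).symm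
      have hprod : (fun u => (((List.finRange N).take (n + 1)).map
            fun k => (lieExp (τ u k • b k) : G)).prod) =
          fun u => (((List.finRange N).take n).map fun k => (lieExp (τ u k • b k) : G)).prod *
            lieExp (τ u ⟨n, hn⟩ • b ⟨n, hn⟩) := by
        ext u
        rw [htake, List.map_append, List.prod_append, List.map_singleton, List.prod_singleton]
      rw [hsum, hprod]
      exact h2
    · have hle : (List.finRange N).length ≤ n := by simpa using hn
      rw [List.take_of_length_le (hle.trans n.le_succ)]
      rwa [List.take_of_length_le hle] at ih

/-- A solution of the Wei–Norman equations gives a curve with constant right velocity. -/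
theorem IsWeiNormanSolution.hasRightVelocityWithinAt {Y : GroupLieAlgebra I G} {s : ℝ}
    {τ : ℝ → Fin N → ℝ} (h : IsWeiNormanSolution b Y s τ) {t : ℝ} (ht : t ∈ Icc 0 s) :
    HasRightVelocityWithinAt I (fun u => (secondKindProduct b (τ u) : G)) Y (Icc 0 s) t := by
  set η := (weiNormanMatrix b (τ t))⁻¹ *ᵥ (b.repr Y : Fin N → ℝ) with hη
  have h1 := hasRightVelocityWithinAt_list_prod b (h.hasDeriv t ht) N
  have hN : (List.finRange N).take N = List.finRange N :=
    List.take_of_length_le (by simp)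
  rw [hN, ← Fin.sum_univ_def] at h1
  have hprod : (fun u => (secondKindProduct b (τ u) : G)) =
      fun u => ((List.finRange N).map fun k => (lieExp (τ u k • b k) : G)).prod := by
    ext u
    rw [secondKindProduct, List.ofFn_eq_map]
  rw [hprod]
  obtain ⟨v, hv⟩ : ∃ v : Fin N → GroupLieAlgebra I G, ∀ j, v j = groupAd I
      (((List.finRange N).take j).map fun k => (lieExp (τ t k • b k) : G)).prod (b j) :=
    ⟨_, fun _ => rfl⟩
  have hY : weiNormanMatrix b (τ t) *ᵥ η = (b.repr Y : Fin N → ℝ) := by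
    rw [hη, Matrix.mulVec_mulVec, Matrix.mul_nonsing_inv _ (h.det_ne_zero t ht).isUnit,
      Matrix.one_mulVec]
  -- The coordinates of $v_j$ form the $j$-th column of $M(\tau(t))$, so in coordinates this is
  -- $M\eta=y$.
  have key : ∑ j, η j • v j = Y := by
    apply b.repr.injective
    ext i
    rw [← hY, map_sum, Finsupp.finsetSum_apply, Matrix.mulVec, dotProduct]
    refine Finset.sum_congr rfl fun j _ => ?_
    rw [map_smul, Finsupp.smul_apply, hv, ← groupAdMatrix_apply, groupAdMatrix_list_prod,
      smul_eq_mul, mul_comm]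
    rfl
  have key' : (∑ j, η j • (groupAd I
      (((List.finRange N).take j).map fun k => (lieExp (τ t k • b k) : G)).prod (b j) : E) : E)
        = Y :=
    (Finset.sum_congr rfl fun j _ => congrArg (fun x : E => η j • x) (hv j).symm).trans key
  exact key' ▸ h1

theorem secondKindProduct_zero : (secondKindProduct b 0 : G) = 1 := by
  simp [secondKindProduct, lieExp_zero]

/-- A solution of the Wei–Norman equations on `[0, 1]` gives canonical coordinates of the second
kind of the exponential. -/
theorem IsWeiNormanSolution.secondKindProduct_eq {Y : GroupLieAlgebra I G} {τ : ℝ → Fin N → ℝ}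
    (h : IsWeiNormanSolution b Y 1 τ) : (secondKindProduct b (τ 1) : G) = lieExp Y :=
  eq_lieExp_of_hasRightVelocityWithinAt (c := fun u => (secondKindProduct b (τ u) : G))
    (by rw [h.initial, secondKindProduct_zero]) fun _ ht => h.hasRightVelocityWithinAt b ht

end Solution

/-! ### Regularity, uniqueness, scaling and extension for the Wei–Norman equations -/

section WeiNormanODE

open Topology

variable {N : ℕ} {L : Type*} [LieRing L] [LieAlgebra ℝ L] (b : Module.Basis (Fin N) ℝ L)

theorem weiNormanMatrix_zero : weiNormanMatrix b 0 = 1 := by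
  ext i j
  have h : ∀ l : List (Fin N), (l.map fun k => expAdMatrix b k ((0 : Fin N → ℝ) k)).prod = 1 := by
    intro l
    apply List.prod_eq_one
    intro A hA
    obtain ⟨k, -, rfl⟩ := List.mem_map.1 hA
    simp [expAdMatrix]
  simp only [weiNormanMatrix, Matrix.of_apply, h]

/-- The right-hand side of the Wei–Norman equations. -/
def weiNormanField (Y : L) (τ : Fin N → ℝ) : Fin N → ℝ :=
  (weiNormanMatrix b τ)⁻¹ *ᵥ (b.repr Y : Fin N → ℝ)

section Smooth

attribute [local instance] Matrix.linftyOpNormedRing Matrix.linftyOpNormedAlgebra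
  Matrix.linftyOpNormedAddCommGroup Matrix.linftyOpNormedSpace

theorem contDiff_expAdMatrix_list_prod (l : List (Fin N)) :
    ContDiff ℝ 1 fun τ : Fin N → ℝ => (l.map fun k => expAdMatrix b k (τ k)).prod := by
  induction l with
  | nil => exact contDiff_const
  | cons k l ih =>
    simp only [List.map_cons, List.prod_cons]
    refine ContDiff.mul ?_ ih
    have h : ContDiff ℝ 1 (NormedSpace.exp : Matrix (Fin N) (Fin N) ℝ → _) :=
      contDiff_iff_contDiffAt.2 fun A =>
        (NormedSpace.exp_analytic (𝕂 := ℝ) A).contDiffAt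
    exact h.comp ((contDiff_apply ℝ ℝ k).smul contDiff_const)

/-- Each column of $M$ comes from a different product; multiplying by the matrix unit $E_{jj}$
isolates the $j$-th one, so smoothness follows from that of sums and products. -/
theorem weiNormanMatrix_eq_sum (τ : Fin N → ℝ) :
    weiNormanMatrix b τ = ∑ j : Fin N, (((List.finRange N).take j).map fun k =>
      expAdMatrix b k (τ k)).prod * Matrix.single j j 1 := by
  ext i j
  rw [Matrix.sum_apply, Finset.sum_eq_single j]
  · simp [weiNormanMatrix]
  · intro k _ hk
    rw [Matrix.mul_single_apply_of_ne]
    exact hk.symm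
  · simp

theorem contDiff_weiNormanMatrix : ContDiff ℝ 1 (weiNormanMatrix b) := by
  have h : weiNormanMatrix b = fun τ => ∑ j : Fin N, (((List.finRange N).take j).map fun k =>
      expAdMatrix b k (τ k)).prod * Matrix.single j j 1 := funext (weiNormanMatrix_eq_sum b)
  rw [h]
  exact ContDiff.sum fun j _ => (contDiff_expAdMatrix_list_prod b _).mul contDiff_const

theorem continuous_weiNormanMatrix_det : Continuous fun τ => (weiNormanMatrix b τ).det :=
  (contDiff_weiNormanMatrix b).continuous.matrix_det

theorem contDiffAt_weiNormanField (Y : L) {τ : Fin N → ℝ} (h : (weiNormanMatrix b τ).det ≠ 0) :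
    ContDiffAt ℝ 1 (weiNormanField b Y) τ := by
  obtain ⟨U, hU⟩ := (Matrix.isUnit_iff_isUnit_det _).2 h.isUnit
  have h1 : ContDiffAt ℝ 1 Ring.inverse (weiNormanMatrix b τ) := hU ▸ contDiffAt_ringInverse ℝ U
  have h2 := h1.comp τ (contDiff_weiNormanMatrix b).contDiffAt
  let c : Matrix (Fin N) (Fin N) ℝ →L[ℝ] (Fin N → ℝ) := LinearMap.toContinuousLinearMap
    ((Matrix.mulVecBilin ℝ ℝ).flip (b.repr Y : Fin N → ℝ))
  have h3 := c.contDiff.contDiffAt.comp τ h2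
  convert h3 using 1
  ext σ i
  simp only [weiNormanField, Matrix.nonsing_inv_eq_ringInverse]
  rfl

end Smooth

variable {b} {Y : L} {s : ℝ} {τ τ' : ℝ → Fin N → ℝ}

theorem IsWeiNormanSolution.continuousOn (h : IsWeiNormanSolution b Y s τ) :
    ContinuousOn τ (Icc 0 s) := fun t ht => (h.hasDeriv t ht).continuousWithinAt

theorem IsWeiNormanSolution.mono (h : IsWeiNormanSolution b Y s τ) {r : ℝ} (hr : r ≤ s) :
    IsWeiNormanSolution b Y r τ where
  initial := h.initial
  det_ne_zero t ht := h.det_ne_zero t (Icc_subset_Icc_right hr ht)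
  hasDeriv t ht :=
    (h.hasDeriv t (Icc_subset_Icc_right hr ht)).mono (Icc_subset_Icc_right hr)

/-- Both trajectories have compact images inside the set $\det M\ne0$. The field is $C^1$ there,
hence Lipschitz on their union, and ODE uniqueness applies. -/
theorem IsWeiNormanSolution.eqOn (h : IsWeiNormanSolution b Y s τ)
    (h' : IsWeiNormanSolution b Y s τ') : EqOn τ τ' (Icc 0 s) := by
  have hdet : ∀ x ∈ τ '' Icc 0 s ∪ τ' '' Icc 0 s, (weiNormanMatrix b x).det ≠ 0 := by
    rintro x (⟨t, ht, rfl⟩ | ⟨t, ht, rfl⟩)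
    · exact h.det_ne_zero t ht
    · exact h'.det_ne_zero t ht
  obtain ⟨K, hK⟩ : ∃ K, LipschitzOnWith K (weiNormanField b Y)
      (τ '' Icc 0 s ∪ τ' '' Icc 0 s) := by
    refine LocallyLipschitzOn.exists_lipschitzOnWith_of_compact
      ((isCompact_Icc.image_of_continuousOn h.continuousOn).union
        (isCompact_Icc.image_of_continuousOn h'.continuousOn)) fun x hx => ?_
    obtain ⟨K, t, ht, hK⟩ := (contDiffAt_weiNormanField b Y (hdet x hx)).exists_lipschitzOnWith
    exact ⟨K, t, mem_nhdsWithin_of_mem_nhds ht, hK⟩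
  have hright : ∀ t ∈ Ico 0 s, Icc 0 s ∈ 𝓝[≥] t := fun t ht => Icc_mem_nhdsGE_of_mem ht
  exact ODE_solution_unique_of_mem_Icc_right (v := fun _ => weiNormanField b Y)
    (s := fun _ => τ '' Icc 0 s ∪ τ' '' Icc 0 s) (fun _ _ => hK) h.continuousOn
    (fun t ht => (h.hasDeriv t (Ico_subset_Icc_self ht)).mono_of_mem_nhdsWithin (hright t ht))
    (fun t ht => Or.inl (mem_image_of_mem _ (Ico_subset_Icc_self ht))) h'.continuousOn
    (fun t ht => (h'.hasDeriv t (Ico_subset_Icc_self ht)).mono_of_mem_nhdsWithin (hright t ht))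
    (fun t ht => Or.inr (mem_image_of_mem _ (Ico_subset_Icc_self ht)))
    (h.initial.trans h'.initial.symm)

/-- The degenerate interval is always solvable. This rules out a blow-up at time 0 and makes the set
of solvable times nonempty. -/
theorem isWeiNormanSolution_zero (b : Module.Basis (Fin N) ℝ L) (Y : L) :
    IsWeiNormanSolution b Y 0 fun _ => 0 where
  initial := rfl
  det_ne_zero t _ := by simp [weiNormanMatrix_zero]
  hasDeriv t _ := by
    rw [Icc_self]
    exact HasFDerivWithinAt.of_subsingleton subsingleton_singleton

/-- The right-hand side is linear in $Y$, so slowing time by $c$ multiplies $Y$ by $c$. -/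
theorem IsWeiNormanSolution.rescale (h : IsWeiNormanSolution b Y s τ) {c : ℝ} (hc : 0 ≤ c)
    {r : ℝ} (hr : c * r ≤ s) : IsWeiNormanSolution b (c • Y) r fun u => τ (c * u) := by
  have hmaps : MapsTo (fun u => c * u) (Icc 0 r) (Icc 0 s) := fun u hu =>
    ⟨mul_nonneg hc hu.1, (mul_le_mul_of_nonneg_left hu.2 hc).trans hr⟩
  refine ⟨by simp [h.initial], fun t ht => h.det_ne_zero _ (hmaps ht), fun t ht => ?_⟩
  have h1 : HasDerivWithinAt (fun u => c * u) c (Icc 0 r) t := by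
    simpa using (hasDerivWithinAt_id t (Icc 0 r)).const_mul c
  have h2 := (h.hasDeriv _ (hmaps ht)).scomp t h1 hmaps
  convert! h2 using 1
  rw [map_smul, Finsupp.coe_smul, Matrix.mulVec_smul]

/-- Invertibility at the closed end point $s$ allows a local solution to start from $\tau(s)$; it
keeps $\det M\ne0$ for a short time and is glued to $\tau$. -/
theorem IsWeiNormanSolution.exists_extension (h : IsWeiNormanSolution b Y s τ) (hs : 0 ≤ s) :
    ∃ δ > 0, ∃ τ', IsWeiNormanSolution b Y (s + δ) τ' := by
  have hsm : s ∈ Icc 0 s := right_mem_Icc.2 hs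
  obtain ⟨α, hα0, ε, hε, hα⟩ :=
    (contDiffAt_weiNormanField b Y (h.det_ne_zero s hsm)
      ).exists_forall_mem_closedBall_exists_eq_forall_mem_Ioo_hasDerivAt₀ s
  have hdet : ∀ᶠ t in 𝓝 s, (weiNormanMatrix b (α t)).det ≠ 0 := by
    have hc : ContinuousAt (fun t => (weiNormanMatrix b (α t)).det) s :=
      (continuous_weiNormanMatrix_det b).continuousAt.comp
        (hα s ⟨by linarith, by linarith⟩).continuousAt
    exact hc.eventually_ne (by rw [hα0]; exact h.det_ne_zero s hsm)
  obtain ⟨ρ, hρ, hball⟩ := Metric.eventually_nhds_iff.1 hdet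
  set δ := min ε ρ / 2 with hδ
  have hδ0 : 0 < δ := half_pos (lt_min hε hρ)
  have hδε : δ < ε := (half_lt_self (lt_min hε hρ)).trans_le (min_le_left _ _)
  have hδρ : δ < ρ := (half_lt_self (lt_min hε hρ)).trans_le (min_le_right _ _)
  set σ : ℝ → Fin N → ℝ := fun t => if t ≤ s then τ t else α t with hσ
  have hσ1 : EqOn σ τ (Icc 0 s) := fun t ht => if_pos ht.2
  have hσ2 : EqOn σ α (Icc s (s + δ)) := by
    intro t ht
    rcases ht.1.eq_or_lt with rfl | hlt
    · simp [hσ, hα0]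
    · exact if_neg (not_le.2 hlt)
  have hunion : Icc 0 (s + δ) = Icc 0 s ∪ Icc s (s + δ) :=
    (Icc_union_Icc_eq_Icc hs (by linarith)).symm
  refine ⟨δ, hδ0, σ, ?_, ?_, ?_⟩
  · rw [hσ1 (left_mem_Icc.2 hs), h.initial]
  · intro t ht
    rw [hunion] at ht
    rcases ht with ht | ht
    · rw [hσ1 ht]
      exact h.det_ne_zero t ht
    · rw [hσ2 ht]
      refine hball ?_
      rw [Real.dist_eq, abs_of_nonneg (by linarith [ht.1])]
      linarith [ht.2]
  · intro t _
    rw [hunion]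
    -- The derivative is checked within each closed piece; where $t$ lies outside a piece, the
    -- condition is vacuous.
    refine HasDerivWithinAt.union ?_ ?_
    · by_cases ht : t ∈ Icc 0 s
      · rw [hσ1 ht]
        exact (h.hasDeriv t ht).congr_of_mem hσ1 ht
      · exact HasFDerivWithinAt.of_notMem_closure (by rwa [closure_Icc])
    · by_cases ht : t ∈ Icc s (s + δ)
      · rw [hσ2 ht]
        exact (hα t ⟨by linarith [ht.1], by linarith [ht.2]⟩).hasDerivWithinAt.congr_of_mem hσ2 ht
      · exact HasFDerivWithinAt.of_notMem_closure (by rwa [closure_Icc])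

end WeiNormanODE

/-! ### The break time and the output of the algorithm -/

section Algorithm

open Topology

variable {N : ℕ} {L : Type*} [LieRing L] [LieAlgebra ℝ L] {b : Module.Basis (Fin N) ℝ L}
  {ε : ℝ} {X : L} {s t : ℝ} {τ : ℝ → Fin N → ℝ}

theorem LoopRuns.mono (h : LoopRuns b ε X s τ) {r : ℝ} (hr : r ≤ s) : LoopRuns b ε X r τ :=
  ⟨h.1.mono hr, fun u hu => h.2 u (Icc_subset_Icc_right hr hu)⟩

/-- The determinant starts at $1>\varepsilon$ and is continuous along the solution, so it exceeds
$\varepsilon$ on some $[0,\delta)$ and $\delta$ is a lower bound for the bad times. -/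
theorem DetBreak.pos (hε1 : ε < 1) (h : DetBreak b ε X t) : 0 < t := by
  obtain ⟨s, τ, -, hτ, hglb⟩ := h
  have hset : {u | u ∈ Icc 0 s ∧ (weiNormanMatrix b (τ u)).det < ε}.Nonempty := hglb.nonempty
  obtain ⟨u₀, hu₀, -⟩ := hset
  have h0 : (0 : ℝ) ∈ Icc 0 s := ⟨le_rfl, hu₀.1.trans hu₀.2⟩
  have hc : ContinuousWithinAt (fun u => (weiNormanMatrix b (τ u)).det) (Icc 0 s) 0 :=
    (continuous_weiNormanMatrix_det b).continuousAt.comp_continuousWithinAt (hτ.continuousOn 0 h0)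
  have hlt : ε < (weiNormanMatrix b (τ 0)).det := by
    rwa [hτ.initial, weiNormanMatrix_zero, Matrix.det_one]
  obtain ⟨δ, hδ, hball⟩ := Metric.mem_nhdsWithin_iff.1 (hc.eventually (lt_mem_nhds hlt))
  refine hδ.trans_le (hglb.2 fun u hu => ?_)
  by_contra! hlt'
  refine lt_asymm hu.2 (hball ⟨?_, hu.1⟩)
  rw [Metric.mem_ball, Real.dist_eq, sub_zero, abs_of_nonneg hu.1.1]
  exact hlt'

theorem BlowUpBreak.pos (h : BlowUpBreak b ε X t) : 0 < t := by
  refine h.1.1.lt_of_ne ?_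
  rintro rfl
  exact h.2.2 ⟨_, isWeiNormanSolution_zero b X⟩

theorem exists_loopRuns_of_break (h : DetBreak b ε X t ∨ BlowUpBreak b ε X t) {r : ℝ}
    (hr0 : 0 ≤ r) (hr : r < t) : ∃ τ, LoopRuns b ε X r τ := by
  rcases h with ⟨s, τ, -, hτ, hglb⟩ | h
  · obtain ⟨u₀, hu₀⟩ := hglb.nonempty
    have hrs : r ≤ s := hr.le.trans ((hglb.1 hu₀).trans hu₀.1.2)
    refine ⟨τ, hτ.mono hrs, fun u hu => ?_⟩
    by_contra! hlt
    exact (hu.2.trans_lt hr).not_ge (hglb.1 ⟨Icc_subset_Icc_right hrs hu, hlt⟩)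
  · exact h.2.1 r ⟨hr0, hr⟩

/-- The alternative `r = 1` covers a break exactly at $t=1$, and so separates the two branches of
the algorithm. -/
theorem not_loopRuns_of_break (h : DetBreak b ε X t ∨ BlowUpBreak b ε X t) {r : ℝ}
    (hr : t < r ∨ r = 1) : ¬ LoopRuns b ε X r τ := by
  intro hτ
  rcases h with ⟨s, σ, hs, hσ, hglb⟩ | h
  · obtain ⟨u, hu, hur⟩ : ∃ u ∈ {u | u ∈ Icc 0 s ∧ (weiNormanMatrix b (σ u)).det < ε}, u ≤ r := by
      rcases hr with hr | rfl
      · obtain ⟨u, hu, -, hur⟩ := hglb.exists_between hr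
        exact ⟨u, hu, hur.le⟩
      · obtain ⟨u, hu⟩ := hglb.nonempty
        exact ⟨u, hu, hu.1.2.trans hs⟩
    have heq := (hσ.mono hu.1.2).eqOn (hτ.1.mono hur) (right_mem_Icc.2 hu.1.1)
    refine (hτ.2 u ⟨hu.1.1, hur⟩).not_gt ?_
    rw [← heq]
    exact hu.2
  · refine h.2.2 ⟨τ, hτ.1.mono ?_⟩
    rcases hr with hr | rfl
    · exact hr.le
    · exact h.1.2

/-- Between two distinct break times the loop would both run, as the later break has not occurred,
and fail to run, as the earlier one has. -/
theorem break_time_unique (hε1 : ε < 1) {t' : ℝ} (h : DetBreak b ε X t ∨ BlowUpBreak b ε X t)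
    (h' : DetBreak b ε X t' ∨ BlowUpBreak b ε X t') : t = t' := by
  have hpos : ∀ {t : ℝ}, DetBreak b ε X t ∨ BlowUpBreak b ε X t → 0 < t :=
    fun h => h.elim (DetBreak.pos hε1) BlowUpBreak.pos
  have key : ∀ {t t' : ℝ}, DetBreak b ε X t ∨ BlowUpBreak b ε X t →
      DetBreak b ε X t' ∨ BlowUpBreak b ε X t' → ¬ t < t' := by
    intro t t' h h' hlt
    obtain ⟨r, hr1, hr2⟩ := exists_between hlt
    obtain ⟨τ, hτ⟩ := exists_loopRuns_of_break h' ((hpos h).trans hr1).le hr2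
    exact not_loopRuns_of_break h (Or.inl hr1) hτ
  exact le_antisymm (not_lt.1 (key h' h)) (not_lt.1 (key h h'))

/-- The first loop either runs to the end or breaks. -/
theorem exists_loopRuns_or_break (b : Module.Basis (Fin N) ℝ L) (ε : ℝ) (X : L) :
    (∃ τ, LoopRuns b ε X 1 τ) ∨ ∃ t, DetBreak b ε X t ∨ BlowUpBreak b ε X t := by
  by_cases hdet : ∃ (s : ℝ) (τ : ℝ → Fin N → ℝ), s ≤ 1 ∧ IsWeiNormanSolution b X s τ ∧
      ∃ u ∈ Icc 0 s, (weiNormanMatrix b (τ u)).det < ε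
  · obtain ⟨s, τ, hs, hτ, u, hu, hlt⟩ := hdet
    exact Or.inr ⟨_, Or.inl ⟨s, τ, hs, hτ, isGLB_csInf ⟨u, hu, hlt⟩ ⟨0, fun v hv => hv.1.1⟩⟩⟩
  push Not at hdet
  have hrun : ∀ s τ, s ≤ 1 → IsWeiNormanSolution b X s τ → LoopRuns b ε X s τ :=
    fun s τ hs hτ => ⟨hτ, hdet s τ hs hτ⟩
  -- The candidate blow-up time is the supremum of the solvable times. If it is itself solvable and
  -- less than 1, the extension contradicts maximality.
  set S : Set ℝ := {s | s ∈ Icc 0 1 ∧ ∃ τ, IsWeiNormanSolution b X s τ} with hS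
  have hS0 : (0 : ℝ) ∈ S := ⟨by simp, _, isWeiNormanSolution_zero b X⟩
  have hSb : BddAbove S := ⟨1, fun s hs => hs.1.2⟩
  have hT0 : 0 ≤ sSup S := le_csSup hSb hS0
  have hT1 : sSup S ≤ 1 := csSup_le ⟨0, hS0⟩ fun s hs => hs.1.2
  by_cases hT : ∃ τ, IsWeiNormanSolution b X (sSup S) τ
  · obtain ⟨τ, hτ⟩ := hT
    rcases hT1.eq_or_lt with h1 | h1
    · rw [h1] at hτ
      exact Or.inl ⟨τ, hrun 1 τ le_rfl hτ⟩
    · obtain ⟨δ, hδ, τ', hτ'⟩ := hτ.exists_extension hT0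
      have hmem : min (sSup S + δ) 1 ∈ S :=
        ⟨⟨le_min (by linarith) zero_le_one, min_le_right _ _⟩, τ', hτ'.mono (min_le_left _ _)⟩
      exact absurd (le_csSup hSb hmem) (not_le.2 (lt_min (by linarith) h1))
  · refine Or.inr ⟨sSup S, Or.inr ⟨⟨hT0, hT1⟩, fun s hs => ?_, hT⟩⟩
    obtain ⟨r, hr, hsr⟩ := exists_lt_of_lt_csSup ⟨0, hS0⟩ hs.2
    obtain ⟨τ, hτ⟩ := hr.2
    exact ⟨τ, hrun s τ (hs.2.le.trans hT1) (hτ.mono hsr.le)⟩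

/-- After a break at time `t`, the Wei–Norman equations for `X / n` with `n > 1 / t` have a
solution on `[0, 1]`. -/
theorem exists_isWeiNormanSolution_rescaled (hε1 : ε < 1)
    (h : DetBreak b ε X t ∨ BlowUpBreak b ε X t) :
    ∃ τ, IsWeiNormanSolution b (((⌊1 / t⌋₊ + 1 : ℕ) : ℝ)⁻¹ • X) 1 τ := by
  have ht : 0 < t := h.elim (DetBreak.pos hε1) BlowUpBreak.pos
  -- The summand 1 makes the inequality strict. This matters since a solution is guaranteed only on
  -- $[0,r]$ with $r<t$.
  have hn : 1 / t < ((⌊1 / t⌋₊ + 1 : ℕ) : ℝ) := by exact_mod_cast Nat.lt_floor_add_one (1 / t)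
  have hlt : ((⌊1 / t⌋₊ + 1 : ℕ) : ℝ)⁻¹ < t := by
    rw [← one_div] at *
    exact (one_div_lt ht ((one_div_pos.2 ht).trans hn)).1 hn
  have hpos : (0 : ℝ) ≤ ((⌊1 / t⌋₊ + 1 : ℕ) : ℝ)⁻¹ := by positivity
  obtain ⟨τ, hτ⟩ := exists_loopRuns_of_break h hpos hlt
  exact ⟨_, hτ.1.rescale hpos (mul_one _).le⟩

theorem existsUnique_algorithmReturns (b : Module.Basis (Fin N) ℝ L) (hε1 : ε < 1) (X : L) :
    ∃ (τ : Fin N → ℝ) (n : ℕ), AlgorithmReturns b ε X τ n ∧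
      ∀ (τ' : Fin N → ℝ) (n' : ℕ), AlgorithmReturns b ε X τ' n' → τ' = τ ∧ n' = n := by
  rcases exists_loopRuns_or_break b ε X with ⟨τ, hτ⟩ | ⟨t, ht⟩
  · refine ⟨τ 1, 1, .direct τ hτ, fun τ' n' h' => ?_⟩
    cases h' with
    | direct σ hσ => exact ⟨hσ.1.eqOn hτ.1 (right_mem_Icc.2 zero_le_one), rfl⟩
    | rescaled t ht => exact absurd hτ (not_loopRuns_of_break ht (Or.inr rfl))
  · obtain ⟨τ, hτ⟩ := exists_isWeiNormanSolution_rescaled hε1 ht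
    refine ⟨τ 1, _, .rescaled t ht _ rfl τ hτ, fun τ' n' h' => ?_⟩
    cases h' with
    | direct σ hσ => exact absurd hσ (not_loopRuns_of_break ht (Or.inr rfl))
    | rescaled t' ht' _ hn' σ hσ =>
      obtain rfl := break_time_unique hε1 ht ht'
      subst hn'
      exact ⟨hσ.eqOn hτ (right_mem_Icc.2 zero_le_one), rfl⟩

/-- With $n=1$ the first branch also solves the equations for $X/n$, so one argument treats both
outputs. -/
theorem AlgorithmReturns.exists_isWeiNormanSolution {σ : Fin N → ℝ} {n : ℕ}
    (h : AlgorithmReturns b ε X σ n) :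
    1 ≤ n ∧ ∃ τ, IsWeiNormanSolution b ((n : ℝ)⁻¹ • X) 1 τ ∧ τ 1 = σ := by
  cases h with
  | direct τ h => exact ⟨le_rfl, τ, by simpa using h.1, rfl⟩
  | rescaled t ht _ hn τ h => exact ⟨hn ▸ Nat.le_add_left _ _, τ, h, rfl⟩

end Algorithm
end

theorem mainTheorem6 {N : ℕ} {G : Type*} [TopologicalSpace G]
    [ChartedSpace (EuclideanSpace ℝ (Fin N)) G] [Group G] [LieGroup (𝓡 N) ∞ G] [T2Space G]
    (b : Module.Basis (Fin N) ℝ (GroupLieAlgebra (𝓡 N) G))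
    (hexp : Function.Surjective (lieExp : GroupLieAlgebra (𝓡 N) G → G))
    (ε : ℝ) (hε0 : 0 < ε) (hε1 : ε < 1)
    (γ : G) (X : GroupLieAlgebra (𝓡 N) G) (hX : γ = lieExp X) :
    ∃ (τ : Fin N → ℝ) (n : ℕ),
      AlgorithmReturns b ε X τ n ∧
      (∀ (τ' : Fin N → ℝ) (n' : ℕ), AlgorithmReturns b ε X τ' n' → τ' = τ ∧ n' = n) ∧
      1 ≤ n ∧
      secondKindProduct b τ = lieExp ((n : ℝ)⁻¹ • X) ∧
      γ = secondKindProduct b τ ^ n := by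
  obtain ⟨σ, n, hret, huniq⟩ := existsUnique_algorithmReturns b hε1 X
  obtain ⟨hn, τ, hτ, rfl⟩ := hret.exists_isWeiNormanSolution
  have hprod : (secondKindProduct b (τ 1) : G) = lieExp ((n : ℝ)⁻¹ • X) :=
    hτ.secondKindProduct_eq b
  refine ⟨τ 1, n, hret, huniq, hn, hprod, ?_⟩
  rw [hprod, ← lieExp_nsmul, smul_inv_smul₀ (Nat.cast_ne_zero.2 (by omega)), hX]
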